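/- **Setting.** Let $\mathbb{C}^2_\times=\mathbb{C}^2\setminus\{0\}$ be the set of nonzero spinors $\kappa=(\xi,\eta)$, on which $SL(2,\mathbb{C})$ acts by matrix multiplication. Let $f(\kappa)=\kappa\kappa^*$, a map to $2\times2$ Hermitian matrices, with directional derivative $D_\kappa f(\nu)=\frac{d}{ds}\big|_{s=0}f(\kappa+s\nu)$, and let $\mathcal Z(\alpha,\beta)=(i\bar\beta,-i\bar\alpha)$. Identify Hermitian matrices with $\mathbb{R}^{1,3}$ by $$g\begin{pmatrix}a&b+ci\\ b-ci&d\end{pmatrix}=(T,X,Y,Z)=(a+d,\,2b,\,2c,\,a-d),$$ and let $\langle\cdot,\cdot\rangle$ be the Minkowski form of signature $(+,-,-,-)$ and $L^+=\{p:\langle p,p\rangle=0,\ T>0\}$. Under $g$, the set $L^+$ corresponds to the cone $\mathcal{H}_0^+$ of Hermitian matrices with determinant $0$ and positive trace. A *pointed oriented null flag* $[[p,v]]$ over either of these cones is a point $p$ of the cone, the plane $V$ spanned by $p$ and a tangent vector $v$ to the cone at $p$ linearly independent of $p$, and the orientation of the line $V/\mathbb{R}p$ given by $v$. * $F(\kappa)=[[f(\kappa),D_\kappa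 f(\mathcal Z\kappa)]]$, and $G$ is the map on flags induced by $g$. * Let $\mathbb{H}=\{x\in\mathbb{R}^{1,3}:\langle x,x\rangle=1,\ T>0\}$ and $h(p)=\{x\in\mathbb{H}:\langle x,p\rangle=1\}$. The map $H$ takes the flag $(p,V,o)$ to the horosphere $h(p)$ with the tangent line field $x\mapsto V\cap T_xh(p)$, oriented through $V\cap T_xh(p)\cong V/\mathbb{R}p$. * Let $\mathbb{D}$ be the open unit ball of $\mathbb{R}^3$ and $\mathbb{U}=\{(x,y,z)\in\mathbb{R}^3: z>0\}$, with the isometries $i:\mathbb{H}\to\mathbb{D}$, $i(T,X,Y,Z)=\frac{1}{1+T}(X,Y,Z)$, and $$j:\mathbb{D}\to\mathbb{U},\qquad j(X,Y,Z)=\frac{(2X,\,2Y,\,1-X^2-Y^2-Z^2)}{X^2+Y^2+(1-Z)^2}$$ (so $j$ extends to the boundary as stereographic projection $(x,y,z)\mapsto (x+iy)/(1-z)$). $I$ and $J$ are the maps induced by $i$, $j$ and their derivatives on horospheres with oriented tangent line fields. $A\in SL(2,\mathbb{C})$ acts on Hermitian matrices by $S\mapsto ASA^*$, on $\mathbb{R}^{1,3}$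 and $\mathbb{H}$ through $g$, and on $\mathbb{D}$ and $\mathbb{U}$ through $i$ and $j$. A *horosphere* in $\mathbb{U}$ is a plane $z=c$ with $c>0$, or a Euclidean sphere tangent to the plane $z=0$ with the point of tangency removed. A *decorated horosphere* in $\mathbb{U}$ is a horosphere with an oriented tangent line field that is parallel, i.e. invariant under the action of every $A\in SL(2,\mathbb{C})$ of trace $\pm2$ that preserves the horosphere. The set of them is $\mathfrak{H}_D(\mathbb{U})$, and $SL(2,\mathbb{C})$ acts on it by its action on $\mathbb{U}$ and the derivative of that action. The manifold structure on $\mathfrak{H}_D(\mathbb{U})$ comes from a bijection with $UTS^2\times\mathbb{R}$, where $UTS^2=\{(u,v)\in\mathbb{R}^3\times\mathbb{R}^3:|u|=|v|=1,\ u\cdot v=0\}$. To $((u,v),t)$ corresponds the decorated horosphere which, carried to $\mathbb{D}$ by $j^{-1}$, is the Euclidean sphere with diameter from $q=\tanh(t/2)\,u$ to $u$, without $u$, with the parallel oriented line field directed by $v$ at $q$. The quotient $\mathbb{C}^2_\times/\{\pm1\}$ carries the charts of $\mathbb{C}^2_\times$ transported along local inverses of the quotient map. **Theorem.** The above correspondence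 is a bijection $UTS^2\times\mathbb{R}\to\mathfrak{H}_D(\mathbb{U})$, and $SL(2,\mathbb{C})$ acts on $\mathfrak{H}_D(\mathbb{U})$ as described. The composition $K=J\circ I\circ H\circ G\circ F$ takes values in $\mathfrak{H}_D(\mathbb{U})$, and $K:\mathbb{C}^2_\times\to\mathfrak{H}_D(\mathbb{U})$ is smooth, surjective, exactly $2$-to-$1$, and $SL(2,\mathbb{C})$-equivariant. It induces a map $\mathbb{C}^2_\times/\{\pm1\}\to\mathfrak{H}_D(\mathbb{U})$, which is smooth, bijective and $SL(2,\mathbb{C})$-equivariant. The actions of $SL(2,\mathbb{C})$ on $\mathbb{C}^2_\times/\{\pm1\}$ and on $\mathfrak{H}_D(\mathbb{U})$ both factor through $PSL(2,\mathbb{C})$. -/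

import Mathlib

open scoped Matrix Manifold ContDiff Topology

noncomputable section

namespace SpinorHoro

/-! ## Spinors -/

/-- The group `SL(2, ℂ)`. -/
abbrev SL2C := Matrix.SpecialLinearGroup (Fin 2) ℂ

/-- The group `PSL(2, ℂ)`: the quotient of `SL(2, ℂ)` by its centre. -/
abbrev PSL2C := Matrix.ProjectiveSpecialLinearGroup (Fin 2) ℂ

/-- Nonzero spinors, `ℂ² ∖ {0}`, as an open submanifold of `ℂ²`. -/
def nonzeroSpinors : TopologicalSpace.Opens (Fin 2 → ℂ) :=
  ⟨{0}ᶜ, isOpen_compl_singleton⟩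

/-- The manifold of nonzero spinors. -/
abbrev Spinor := ↥nonzeroSpinors

theorem Spinor.ne_zero (κ : Spinor) : (κ : Fin 2 → ℂ) ≠ 0 := κ.2

instance : LocallyCompactSpace Spinor :=
  nonzeroSpinors.isOpen.locallyCompactSpace

/-- `SL(2, ℂ)` acts on nonzero spinors by matrix multiplication. -/
instance : MulAction SL2C Spinor where
  smul A κ := ⟨A • (κ : Fin 2 → ℂ), fun h => Spinor.ne_zero κ (by
    have h' : A • (κ : Fin 2 → ℂ) = 0 := h
    simpa using congrArg (fun v => A⁻¹ • v) h')⟩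
  one_smul κ := Subtype.ext (one_smul SL2C (κ : Fin 2 → ℂ))
  mul_smul A B κ := Subtype.ext (mul_smul A B (κ : Fin 2 → ℂ))

/-- The group `{1, -1}` acts on nonzero spinors by multiplication. -/
instance : SMul ℤˣ Spinor where
  smul e κ := ⟨e • (κ : Fin 2 → ℂ), fun h => Spinor.ne_zero κ (by
    have h' : e • (κ : Fin 2 → ℂ) = 0 := h
    have h2 := congrArg (fun v => e⁻¹ • v) h'
    simp only [inv_smul_smul] at h2
    rw [h2, Units.smul_def, smul_zero])⟩

instance : MulAction ℤˣ Spinor where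
  one_smul κ := Subtype.ext (one_smul ℤˣ (κ : Fin 2 → ℂ))
  mul_smul e e' κ := Subtype.ext (mul_smul e e' (κ : Fin 2 → ℂ))

theorem Spinor.coe_smul (A : SL2C) (κ : Spinor) :
    ((A • κ : Spinor) : Fin 2 → ℂ) = (A : Matrix (Fin 2) (Fin 2) ℂ) *ᵥ (κ : Fin 2 → ℂ) := rfl

theorem Spinor.coe_units_smul (e : ℤˣ) (κ : Spinor) :
    ((e • κ : Spinor) : Fin 2 → ℂ) = e • (κ : Fin 2 → ℂ) := rfl

theorem Spinor.coe_neg_one_smul (κ : Spinor) :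
    (((-1 : ℤˣ) • κ : Spinor) : Fin 2 → ℂ) = -(κ : Fin 2 → ℂ) := by
  rw [Spinor.coe_units_smul, Units.smul_def]; simp

instance : ContinuousConstSMul ℤˣ Spinor where
  continuous_const_smul e := by
    refine Continuous.subtype_mk ?_ _
    have : Continuous fun v : Fin 2 → ℂ => e • v := by
      rcases Int.units_eq_one_or e with rfl | rfl
      · simpa using continuous_id'
      · simpa [Units.smul_def] using continuous_neg
    exact this.comp continuous_subtype_val

theorem Spinor.neg_one_smul_ne (κ : Spinor) : (-1 : ℤˣ) • κ ≠ κ := by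
  intro h
  have h' := congrArg (fun x : Spinor => (x : Fin 2 → ℂ)) h
  simp only [Spinor.coe_neg_one_smul] at h'
  exact Spinor.ne_zero κ (neg_eq_self.mp h')

instance : IsCancelSMul ℤˣ Spinor where
  right_cancel' e e' κ h := by
    rcases Int.units_eq_one_or e with rfl | rfl <;> rcases Int.units_eq_one_or e' with rfl | rfl
    · rfl
    · exact absurd (h.symm.trans (one_smul _ _)) (Spinor.neg_one_smul_ne κ)
    · exact absurd (h.trans (one_smul _ _)) (Spinor.neg_one_smul_ne κ)
    · rfl

instance : SMulCommClass SL2C ℤˣ Spinor where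
  smul_comm A e κ := Subtype.ext (by
    rcases Int.units_eq_one_or e with rfl | rfl
    · simp
    · rw [Spinor.coe_smul, Spinor.coe_neg_one_smul, Spinor.coe_neg_one_smul, Spinor.coe_smul,
        Matrix.mulVec_neg])

/-- The quotient `(ℂ² ∖ {0}) / {±1}`. It carries the charts of `Spinor`, transported along local
inverses of the quotient map (`MulAction.instChartedSpaceQuotient`). -/
abbrev SpinorModSign := MulAction.orbitRel.Quotient ℤˣ Spinor

/-- The quotient map `ℂ² ∖ {0} → (ℂ² ∖ {0}) / {±1}`. -/
def modSign (κ : Spinor) : SpinorModSign := Quotient.mk _ κ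

/-- The action of `SL(2, ℂ)` on `(ℂ² ∖ {0}) / {±1}`, given by `A • [κ] = [A • κ]`. -/
instance : MulAction SL2C SpinorModSign where
  smul A := Quotient.map (fun κ : Spinor => A • κ) (by
    rintro _ κ ⟨e, rfl⟩
    exact ⟨e, (smul_comm A e κ).symm⟩)
  one_smul x := by
    induction x using Quotient.inductionOn with
    | h κ => exact congrArg modSign (one_smul SL2C κ)
  mul_smul A B x := by
    induction x using Quotient.inductionOn with
    | h κ => exact congrArg modSign (mul_smul A B κ)

theorem smul_mod (A : SL2C) (κ : Spinor) : A • modSign κ = modSign (A • κ) := rfl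

/-! ## Tangent vectors and pointed oriented null flags -/

/-- The tangent vectors to a subset `S` of a vector space at a point `q`: the velocities of curves
through `q` that run in `S`. -/
def tangentVectors {E : Type*} [AddCommGroup E] [Module ℝ E] [TopologicalSpace E]
    [ContinuousSMul ℝ E] (S : Set E) (q : E) : Set E :=
  {w | ∃ γ : ℝ → E, γ 0 = q ∧ (∀ᶠ s in 𝓝 (0 : ℝ), γ s ∈ S) ∧ HasDerivAt γ w 0}

/-- The open half-plane `ℝ p + ℝ⁺ v`. -/
def halfPlane {E : Type*} [AddCommGroup E] [Module ℝ E] (p v : E) : Set E :=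
  {w | ∃ a b : ℝ, 0 < b ∧ w = a • p + b • v}

/-- A pointed oriented null flag `[[p, v]]` over a cone `C` (without its apex): a point `p` of `C`,
a plane `V` spanned by `p` and a tangent vector `v` to `C` at `p`, and an orientation of the line
`V / ℝ p`. The orientation is recorded as the set of vectors of `V` that represent positive elements
of `V / ℝ p`, which is the half-plane `ℝ p + ℝ⁺ v`. -/
structure NullFlag {E : Type*} [AddCommGroup E] [Module ℝ E] [TopologicalSpace E]
    [ContinuousSMul ℝ E] (C : Set E) where
  point : E
  point_mem : point ∈ C
  plane : Submodule ℝ E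
  pos : Set E
  spanned : ∃ v ∈ tangentVectors C point, LinearIndependent ℝ ![point, v] ∧
    plane = Submodule.span ℝ {point, v} ∧ pos = halfPlane point v

/-- The flag `[[p, v]]`. -/
def NullFlag.of {E : Type*} [AddCommGroup E] [Module ℝ E] [TopologicalSpace E]
    [ContinuousSMul ℝ E] {C : Set E} (p v : E) (hp : p ∈ C) (hv : v ∈ tangentVectors C p) (hpv : LinearIndependent ℝ ![p, v]) :
    NullFlag C where
  point := p
  point_mem := hp
  plane := Submodule.span ℝ {p, v}
  pos := halfPlane p v
  spanned := ⟨v, hv, hpv, rfl, rfl⟩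

/-! ## From spinors to flags in Hermitian matrices -/

/-- `2 × 2` Hermitian matrices, a real vector space of dimension four. -/
abbrev Herm := selfAdjoint (Matrix (Fin 2) (Fin 2) ℂ)

instance : ContinuousSMul ℝ Herm where
  continuous_smul := by
    refine Continuous.subtype_mk ?_ _
    exact continuous_fst.smul (continuous_subtype_val.comp continuous_snd)

/-- The Hermitian matrix `M` with `M = ((a, b + c i), (b - c i, d))`. -/
def herm (a b c d : ℝ) : Herm :=
  ⟨!![(a : ℂ), b + c * Complex.I; b - c * Complex.I, d], by
    rw [selfAdjoint.mem_iff, Matrix.star_eq_conjTranspose]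
    ext i j
    fin_cases i <;> fin_cases j <;> simp [Matrix.conjTranspose_apply, sub_eq_add_neg]⟩

/-- The cone of nonzero Hermitian matrices with determinant zero and positive trace. -/
def hermCone : Set Herm :=
  {S | (S : Matrix (Fin 2) (Fin 2) ℂ).det = 0 ∧ 0 < (S : Matrix (Fin 2) (Fin 2) ℂ).trace.re}

/-- The map `f(κ) = κ κ*` from spinors to Hermitian matrices. -/
def spinorSq (κ : Fin 2 → ℂ) : Herm :=
  ⟨Matrix.vecMulVec κ (star κ), by
    rw [selfAdjoint.mem_iff, Matrix.star_eq_conjTranspose, Matrix.conjTranspose_vecMulVec,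
      star_star]⟩

/-- The derivative `D_κ f (ν)` of `f` at `κ` in the direction `ν`. -/
def spinorSqDeriv (κ ν : Fin 2 → ℂ) : Herm := deriv (fun s : ℝ => spinorSq (κ + s • ν)) 0

/-- The map `(α, β) ↦ (i conj β, -i conj α)` on spinors. -/
def spinorZ (κ : Fin 2 → ℂ) : Fin 2 → ℂ :=
  ![star (κ 1) * Complex.I, -(star (κ 0) * Complex.I)]

theorem spinorSq_apply (κ : Fin 2 → ℂ) (i j : Fin 2) :
    (spinorSq κ : Matrix (Fin 2) (Fin 2) ℂ) i j = κ i * star (κ j) := rfl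

/-- `D_κ f (ν) = κ ν* + ν κ*`. -/
theorem hasDerivAt_spinorSq (κ ν : Fin 2 → ℂ) :
    HasDerivAt (fun s : ℝ => spinorSq (κ + s • ν))
      (spinorSq (κ + ν) - spinorSq κ - spinorSq ν) 0 := by
  refine HasFDerivAt.of_isLittleOTVS ?_
  have h0 : Filter.Tendsto (fun s : ℝ => s • spinorSq ν) (𝓝 0) (𝓝 0) := by
    have h : Continuous fun s : ℝ => s • spinorSq ν := by fun_prop
    simpa using h.tendsto 0
  have h1 := ((Asymptotics.isLittleOTVS_one (𝕜 := ℝ)).2 h0).smul_left (fun s : ℝ => s)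
  refine h1.congr (fun s => ?_) (fun s => ?_)
  · ext i j
    simp [spinorSq_apply]
    ring
  · simp

theorem spinorSqDeriv_eq (κ ν : Fin 2 → ℂ) :
    spinorSqDeriv κ ν = spinorSq (κ + ν) - spinorSq κ - spinorSq ν := by
  have h := (hasDerivAt_spinorSq κ ν).hasFDerivAt
  rw [spinorSqDeriv, deriv, h.differentiableAt.hasFDerivAt.unique h]
  simp

theorem spinorSqDeriv_apply (κ ν : Fin 2 → ℂ) (i j : Fin 2) :
    (spinorSqDeriv κ ν : Matrix (Fin 2) (Fin 2) ℂ) i j = κ i * star (ν j) + ν i * star (κ j) := by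
  rw [spinorSqDeriv_eq]
  simp [spinorSq_apply]
  ring

theorem spinorSq_mem_hermCone {κ : Fin 2 → ℂ} (hκ : κ ≠ 0) : spinorSq κ ∈ hermCone := by
  refine ⟨?_, ?_⟩
  · rw [Matrix.det_fin_two]
    simp only [spinorSq_apply]
    ring
  · rw [Matrix.trace_fin_two]
    simp only [spinorSq_apply, Complex.star_def, Complex.mul_conj, Complex.add_re,
      Complex.ofReal_re]
    rcases eq_or_ne (κ 0) 0 with h0 | h0
    · have h1 : κ 1 ≠ 0 := fun h1 => hκ (by ext i; fin_cases i <;> simp [h0, h1])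
      have := Complex.normSq_pos.2 h1
      have := Complex.normSq_nonneg (κ 0)
      linarith
    · have := Complex.normSq_pos.2 h0
      have := Complex.normSq_nonneg (κ 1)
      linarith

theorem spinorSqDeriv_mem_tangentVectors {κ : Fin 2 → ℂ} (hκ : κ ≠ 0) (ν : Fin 2 → ℂ) :
    spinorSqDeriv κ ν ∈ tangentVectors hermCone (spinorSq κ) := by
  refine ⟨fun s => spinorSq (κ + s • ν), by simp, ?_, ?_⟩
  · have hc : Continuous fun s : ℝ => κ + s • ν := by fun_prop
    have h0 : ∀ᶠ s in 𝓝 (0 : ℝ), κ + s • ν ≠ 0 :=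
      hc.continuousAt.eventually_ne (by simpa using hκ)
    exact h0.mono fun s hs => spinorSq_mem_hermCone hs
  · rw [spinorSqDeriv_eq]
    exact hasDerivAt_spinorSq κ ν

theorem linearIndependent_flag {κ : Fin 2 → ℂ} (hκ : κ ≠ 0) :
    LinearIndependent ℝ ![spinorSq κ, spinorSqDeriv κ (spinorZ κ)] := by
  rw [LinearIndependent.pair_iff]
  intro s t h
  have hij : ∀ i j, (s : ℂ) * (κ i * star (κ j)) +
      t * (κ i * star (spinorZ κ j) + spinorZ κ i * star (κ j)) = 0 := fun i j => by
    have := congrArg (fun M : Herm => (M : Matrix (Fin 2) (Fin 2) ℂ) i j) h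
    simpa [spinorSq_apply, spinorSqDeriv_apply, mul_add] using this
  have h00 := hij 0 0
  have h01 := hij 0 1
  have h11 := hij 1 1
  have hpos : 0 < Complex.normSq (κ 0) + Complex.normSq (κ 1) := by
    have := (spinorSq_mem_hermCone hκ).2
    rw [Matrix.trace_fin_two] at this
    simpa only [spinorSq_apply, Complex.star_def, Complex.mul_conj, Complex.add_re,
      Complex.ofReal_re] using this
  rw [Complex.ext_iff] at h00 h01 h11
  simp [spinorZ, Complex.normSq] at h00 h01 h11 hpos
  generalize (κ 0).re = a at *
  generalize (κ 0).im = b at *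
  generalize (κ 1).re = c at *
  generalize (κ 1).im = d at *
  have hs : s = 0 := by
    have : s * (a * a + b * b + (c * c + d * d)) = 0 := by linear_combination h00.1 + h11.1
    exact (mul_eq_zero.1 this).resolve_right hpos.ne'
  subst hs
  refine ⟨rfl, ?_⟩
  have : t * (a * a + b * b + (c * c + d * d)) ^ 2 = 0 := by
    linear_combination (2 * (a * d + b * c)) * h00.1 + (2 * (c * d - a * b)) * h01.1 +
      (a * a - b * b - d * d + c * c) * h01.2
  exact (mul_eq_zero.1 this).resolve_right (pow_ne_zero 2 hpos.ne')

/-- The map `F` from nonzero spinors to flags: `F(κ) = [[f(κ), D_κ f (Z κ)]]`, where `Z` is the map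
`spinorZ`. -/
def mapF (κ : Spinor) : NullFlag hermCone :=
  NullFlag.of (spinorSq κ) (spinorSqDeriv κ (spinorZ κ))
    (spinorSq_mem_hermCone (Spinor.ne_zero κ))
    (spinorSqDeriv_mem_tangentVectors (Spinor.ne_zero κ) _)
    (linearIndependent_flag (Spinor.ne_zero κ))

/-! ## Minkowski space -/

/-- Minkowski space, with coordinates `(T, X, Y, Z) = (p 0, p 1, p 2, p 3)`. -/
abbrev Mink := Fin 4 → ℝ

/-- The Minkowski inner product, of signature `(+, -, -, -)`. -/
def minkInner (p q : Mink) : ℝ := p 0 * q 0 - p 1 * q 1 - p 2 * q 2 - p 3 * q 3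

/-- The positive light cone. -/
def lightCone : Set Mink := {p | minkInner p p = 0 ∧ 0 < p 0}

theorem Herm.conj_apply (M : Herm) (i j : Fin 2) : (starRingEnd ℂ) (M.1 i j) = M.1 j i := by
  have h := congrArg (fun N : Matrix (Fin 2) (Fin 2) ℂ => N j i) (selfAdjoint.mem_iff.1 M.2)
  rw [Matrix.star_eq_conjTranspose] at h
  exact h

/-- The isomorphism `g` from Hermitian matrices to Minkowski space, taking
`((a, b + c i), (b - c i, d))` to `(a + d, 2 b, 2 c, a - d)`. -/
def hermEquiv : Herm ≃ₗ[ℝ] Mink where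
  toFun M := ![(M.1 0 0).re + (M.1 1 1).re, 2 * (M.1 0 1).re, 2 * (M.1 0 1).im,
    (M.1 0 0).re - (M.1 1 1).re]
  invFun p := herm ((p 0 + p 3) / 2) (p 1 / 2) (p 2 / 2) ((p 0 - p 3) / 2)
  map_add' M N := by
    ext i
    fin_cases i <;> simp <;> ring
  map_smul' r M := by
    ext i
    fin_cases i <;> simp <;> ring
  left_inv M := by
    have h00 := Herm.conj_apply M 0 0
    have h01 := Herm.conj_apply M 0 1
    have h11 := Herm.conj_apply M 1 1
    ext i j
    fin_cases i <;> fin_cases j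
    · simp [Complex.ext_iff, herm] at h00 ⊢
      linarith
    · simp [herm]
    · simp [Complex.ext_iff, herm] at h01 ⊢
      exact h01
    · simp [Complex.ext_iff, herm] at h11 ⊢
      linarith
  right_inv p := by
    ext i
    fin_cases i <;> simp [herm] <;> ring

theorem continuous_hermEquiv : Continuous hermEquiv := by
  refine continuous_pi fun i => ?_
  have h : ∀ i j, Continuous fun M : Herm => M.1 i j := fun i j =>
    (continuous_subtype_val.matrix_elem i j)
  fin_cases i
  · exact (Complex.continuous_re.comp (h 0 0)).add (Complex.continuous_re.comp (h 1 1))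
  · exact continuous_const.mul (Complex.continuous_re.comp (h 0 1))
  · exact continuous_const.mul (Complex.continuous_im.comp (h 0 1))
  · exact (Complex.continuous_re.comp (h 0 0)).sub (Complex.continuous_re.comp (h 1 1))

theorem hermEquiv_mem_lightCone {M : Herm} (hM : M ∈ hermCone) : hermEquiv M ∈ lightCone := by
  obtain ⟨hdet, htr⟩ := hM
  have h00 := Herm.conj_apply M 0 0
  have h01 := Herm.conj_apply M 0 1
  have h11 := Herm.conj_apply M 1 1
  rw [Matrix.det_fin_two, ← h01] at hdet
  rw [Matrix.trace_fin_two] at htr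
  rw [Complex.ext_iff] at h00 h11 hdet
  refine ⟨?_, by simpa [hermEquiv] using htr⟩
  simp at h00 h11 hdet htr
  have h00' : (M.1 0 0).im = 0 := by linarith
  have h11' : (M.1 1 1).im = 0 := by linarith
  simp only [h00', h11'] at hdet
  simp [minkInner, hermEquiv]
  linear_combination 4 * hdet.1

theorem hermEquiv_mem_tangentVectors {M W : Herm} (hW : W ∈ tangentVectors hermCone M) :
    hermEquiv W ∈ tangentVectors lightCone (hermEquiv M) := by
  obtain ⟨γ, h0, hγ, hd⟩ := hW
  refine ⟨fun s => hermEquiv (γ s), by simp [h0], hγ.mono fun s hs => hermEquiv_mem_lightCone hs, ?_⟩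
  let G : Herm →L[ℝ] Mink := ⟨hermEquiv.toLinearMap, continuous_hermEquiv⟩
  refine HasFDerivAt.of_isLittleOTVS ?_
  have h := (G.isBigOTVS_comp (l := 𝓝 (0 : ℝ))).trans_isLittleOTVS hd.hasFDerivAt.isLittleOTVS
  refine h.congr (fun s => ?_) (fun s => rfl)
  simp [G]

/-- The map `G` from flags in Hermitian matrices to flags in Minkowski space, induced by the linear
isomorphism `g`. -/
def mapG (P : NullFlag hermCone) : NullFlag lightCone where
  point := hermEquiv P.point
  point_mem := hermEquiv_mem_lightCone P.point_mem
  plane := P.plane.map hermEquiv.toLinearMap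
  pos := hermEquiv '' P.pos
  spanned := by
    obtain ⟨v, hv, hli, hpl, hpos⟩ := P.spanned
    refine ⟨hermEquiv v, hermEquiv_mem_tangentVectors hv, ?_, ?_, ?_⟩
    · have := hli.map' hermEquiv.toLinearMap hermEquiv.ker
      have he : ⇑hermEquiv.toLinearMap ∘ ![P.point, v] = ![hermEquiv P.point, hermEquiv v] := by
        ext i
        fin_cases i <;> rfl
      exact he ▸ this
    · rw [hpl, Submodule.map_span, Set.image_pair]; rfl
    · rw [hpos]
      ext w
      constructor
      · rintro ⟨_, ⟨a, b, hb, rfl⟩, rfl⟩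
        exact ⟨a, b, hb, by simp⟩
      · rintro ⟨a, b, hb, rfl⟩
        exact ⟨_, ⟨a, b, hb, rfl⟩, by simp⟩

/-! ## Horospheres with a line field -/

/-- A subset of a vector space (in practice a horosphere in a model of hyperbolic space), with a
set of directing vectors at each point. -/
@[ext]
structure OverlyDecorated (E : Type*) where
  carrier : Set E
  dir : E → Set E

/-- `dir` is an oriented tangent line field on `carrier`: at every point of `carrier` it is the open
half-line generated by some nonzero tangent vector, that is, the positive half of an oriented tangent
line. -/
def OverlyDecorated.IsOrientedLineField {E : Type*} [AddCommGroup E] [Module ℝ E]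
    [TopologicalSpace E] [ContinuousSMul ℝ E] (S : OverlyDecorated E) : Prop :=
  (∀ q ∈ S.carrier, ∃ w ∈ tangentVectors S.carrier q, w ≠ 0 ∧
    S.dir q = {x | ∃ c : ℝ, 0 < c ∧ x = c • w}) ∧
  ∀ q ∉ S.carrier, S.dir q = ∅

/-- The image under a map `φ` and its derivative. -/
def OverlyDecorated.map {E E' : Type*} [NormedAddCommGroup E] [NormedSpace ℝ E]
    [NormedAddCommGroup E'] [NormedSpace ℝ E'] (φ : E → E') (S : OverlyDecorated E) :
    OverlyDecorated E' where
  carrier := φ '' S.carrier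
  dir y := {x | ∃ q ∈ S.carrier, φ q = y ∧ ∃ w ∈ S.dir q, x = fderiv ℝ φ q w}

/-- The hyperboloid model of hyperbolic space. -/
def hyperboloid : Set Mink := {x | minkInner x x = 1 ∧ 0 < x 0}

/-- The map `H`: a flag `(p, V, o)` goes to the horosphere `h(p) = {x | ⟨x, p⟩ = 1}` of the
hyperboloid, with the oriented line field given at `x` by the line `V ∩ T_x h(p)`, oriented by the
isomorphism of this line with `V / ℝ p`. -/
def mapH (P : NullFlag lightCone) : OverlyDecorated Mink where
  carrier := {x | x ∈ hyperboloid ∧ minkInner x P.point = 1}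
  dir x := {w | x ∈ hyperboloid ∧ minkInner x P.point = 1 ∧ w ∈ P.pos ∧
    w ∈ tangentVectors {x | x ∈ hyperboloid ∧ minkInner x P.point = 1} x}

/-- Three-dimensional space, containing the disc model `disc` and the upper half space model
`upperHalf` of hyperbolic space. -/
abbrev R3 := Fin 3 → ℝ

/-- The disc model: the open unit ball. -/
def disc : Set R3 := {y | y ⬝ᵥ y < 1}

/-- The upper half space model. -/
def upperHalf : Set R3 := {y | 0 < y 2}

/-- The isometry from the hyperboloid to the disc model, projection from `(-1, 0, 0, 0)`. -/
def iMap (x : Mink) : R3 := ![x 1 / (1 + x 0), x 2 / (1 + x 0), x 3 / (1 + x 0)]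

/-- The inverse of `iMap`. -/
def iInv (y : R3) : Mink :=
  ![(1 + y ⬝ᵥ y) / (1 - y ⬝ᵥ y), 2 * y 0 / (1 - y ⬝ᵥ y), 2 * y 1 / (1 - y ⬝ᵥ y),
    2 * y 2 / (1 - y ⬝ᵥ y)]

/-- The isometry from the disc model to the upper half space model which on the boundary is the
stereographic projection `(x, y, z) ↦ (x + i y) / (1 - z)`. -/
def jMap (y : R3) : R3 :=
  ![2 * y 0 / (y 0 ^ 2 + y 1 ^ 2 + (1 - y 2) ^ 2), 2 * y 1 / (y 0 ^ 2 + y 1 ^ 2 + (1 - y 2) ^ 2),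
    (1 - y ⬝ᵥ y) / (y 0 ^ 2 + y 1 ^ 2 + (1 - y 2) ^ 2)]

/-- The inverse of `jMap`. -/
def jInv (y : R3) : R3 :=
  ![2 * y 0 / (y 0 ^ 2 + y 1 ^ 2 + (y 2 + 1) ^ 2), 2 * y 1 / (y 0 ^ 2 + y 1 ^ 2 + (y 2 + 1) ^ 2),
    (y ⬝ᵥ y - 1) / (y 0 ^ 2 + y 1 ^ 2 + (y 2 + 1) ^ 2)]

/-- The map `I`, induced by the isometry from the hyperboloid to the disc model. -/
def mapI (S : OverlyDecorated Mink) : OverlyDecorated R3 := S.map iMap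

/-- The map `J`, induced by the isometry from the disc model to the upper half space model. -/
def mapJ (S : OverlyDecorated R3) : OverlyDecorated R3 := S.map jMap

/-! ## The action of `SL(2, ℂ)` on the models -/

/-- The action of `A` on Hermitian matrices, `S ↦ A S A*`. -/
def actHerm (A : SL2C) (S : Herm) : Herm :=
  ⟨(A : Matrix (Fin 2) (Fin 2) ℂ) * S.1 * star (A : Matrix (Fin 2) (Fin 2) ℂ), by
    rw [selfAdjoint.mem_iff, star_mul, star_mul, star_star, selfAdjoint.mem_iff.1 S.2, mul_assoc]⟩

/-- The action of `A` on Minkowski space, transported by `g`. -/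
def actMink (A : SL2C) (p : Mink) : Mink := hermEquiv (actHerm A (hermEquiv.symm p))

/-- The action of `A` on the disc model, transported from the hyperboloid. -/
def actDisc (A : SL2C) (y : R3) : R3 := iMap (actMink A (iInv y))

/-- The action of `A` on the upper half space model, transported from the disc model. -/
def actUpper (A : SL2C) (y : R3) : R3 := jMap (actDisc A (jInv y))

/-! ## Decorated horospheres in the upper half space model -/

/-- The horospheres of the upper half space model: horizontal planes, and Euclidean spheres tangent
to the boundary plane with the point of tangency removed. -/
def IsHorosphere (s : Set R3) : Prop :=
  (∃ c : ℝ, 0 < c ∧ s = {y | y 2 = c}) ∨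
  ∃ a b r : ℝ, 0 < r ∧
    s = {y | y ∈ upperHalf ∧ (y 0 - a) ^ 2 + (y 1 - b) ^ 2 + (y 2 - r) ^ 2 = r ^ 2}

/-- The oriented line field is parallel: it is invariant under every parabolic isometry (a matrix
of trace `2` or `-2`) that preserves the horosphere. -/
def OverlyDecorated.IsParallel (S : OverlyDecorated R3) : Prop :=
  ∀ A : SL2C, ((A : Matrix (Fin 2) (Fin 2) ℂ).trace = 2 ∨
    (A : Matrix (Fin 2) (Fin 2) ℂ).trace = -2) →
    actUpper A '' S.carrier = S.carrier → S.map (actUpper A) = S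

/-- The decorated horospheres of the upper half space model: horospheres with a parallel oriented
tangent line field. -/
def DecoratedHorosphere :=
  {S : OverlyDecorated R3 // IsHorosphere S.carrier ∧ S.IsOrientedLineField ∧ S.IsParallel}

/-! ## The smooth structure on decorated horospheres -/

/-- The unit tangent bundle of the unit sphere, as pairs of a point `u` and a unit vector
orthogonal to `u`. -/
def UTS2 := {x : R3 × R3 // x.1 ⬝ᵥ x.1 = 1 ∧ x.2 ⬝ᵥ x.2 = 1 ∧ x.1 ⬝ᵥ x.2 = 0}

/-- The coordinates of a decorated horosphere in `UTS² × ℝ`, described in the disc model. The point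
`u` is the centre of the horosphere on the sphere at infinity. The number `t` is the signed distance,
from the origin towards `u`, of the point `q` where the horosphere meets the diameter of the ball
through `u`, so that `q = tanh (t / 2) u`, and the horosphere is the sphere with diameter from `q` to `u`
without the point `u`. The vector `v` is the direction of the line field at `q`. -/
def HasCoordinates (D : DecoratedHorosphere) (x : UTS2 × ℝ) : Prop :=
  let u : R3 := x.1.1.1
  let v : R3 := x.1.1.2
  let q : R3 := Real.tanh (x.2 / 2) • u
  D.1.carrier = jMap '' {y | y ∈ disc ∧ (y - q) ⬝ᵥ (y - u) = 0} ∧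
  fderiv ℝ jMap q v ∈ D.1.dir (jMap q)

/-- A map from a manifold to `UTS² × ℝ` is smooth: it is smooth as a map to `ℝ³ × ℝ³ × ℝ`, which
contains `UTS² × ℝ` as an embedded submanifold. -/
def SmoothToUTS2 {M : Type*} [TopologicalSpace M] [ChartedSpace (Fin 2 → ℂ) M]
    (φ : M → UTS2 × ℝ) : Prop :=
  ContMDiff 𝓘(ℝ, Fin 2 → ℂ) 𝓘(ℝ, (R3 × R3) × ℝ) ∞ fun m => ((φ m).1.1, (φ m).2)

end SpinorHoro

end

open scoped MatrixGroups Manifold ContDiff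
open SpinorHoro

/-!
A spinor `κ` determines the null vector `p = g(κκ*)` and the direction of its flag, and a phase `l`
turns that direction about `p` by twice the argument of `l`; hence the point `p / T(p)` of the
sphere at infinity, the flag direction and `log T(p)` are smooth coordinates which identify spinors
up to sign with `UTS² × ℝ`.

Every stage of the construction is equivariant: modulo `A κ`, the vector `Z(A κ)` is a positive
multiple of `A (Z κ)`. As `SL(2, ℂ)` acts transitively on spinors and on horospheres, everything
about decorations can be checked on the plane `z = 1`. The spinors over this plane are `(ξ, 0)` with
`|ξ| = 1`, and their line field is the constant one directed by `i ξ²`, so it determines `ξ` up to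
sign. The matrices of trace `±2` preserving the plane are `±((1, b), (0, 1))`, which translate it by
`b`, so the parallel line fields on it are the constant ones.
-/

namespace SpinorHoro

open scoped Matrix Topology

noncomputable section

/-! ## Half-lines and half-planes -/

section HalfPlane

variable {E E' : Type*} [AddCommGroup E] [Module ℝ E] [AddCommGroup E'] [Module ℝ E']

/-- The open half-line `ℝ⁺ w`, which records an oriented line in `OverlyDecorated.dir`. -/
def openRay (w : E) : Set E := {x | ∃ c : ℝ, 0 < c ∧ x = c • w}

theorem self_mem_openRay (w : E) : w ∈ openRay w := ⟨1, one_pos, (one_smul ℝ w).symm⟩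

theorem openRay_smul {c : ℝ} (hc : 0 < c) (w : E) : openRay (c • w) = openRay w := by
  ext x
  constructor
  · rintro ⟨d, hd, rfl⟩
    exact ⟨d * c, mul_pos hd hc, smul_smul d c w⟩
  · rintro ⟨d, hd, rfl⟩
    exact ⟨d / c, div_pos hd hc, by rw [smul_smul, div_mul_cancel₀ d hc.ne']⟩

theorem image_openRay (L : E →ₗ[ℝ] E') (w : E) : L '' openRay w = openRay (L w) := by
  ext x
  constructor
  · rintro ⟨_, ⟨c, hc, rfl⟩, rfl⟩
    exact ⟨c, hc, map_smul L c w⟩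
  · rintro ⟨c, hc, rfl⟩
    exact ⟨c • w, ⟨c, hc, rfl⟩, map_smul L c w⟩

theorem image_halfPlane (L : E →ₗ[ℝ] E') (p v : E) :
    L '' halfPlane p v = halfPlane (L p) (L v) := by
  ext x
  constructor
  · rintro ⟨_, ⟨a, b, hb, rfl⟩, rfl⟩
    exact ⟨a, b, hb, by simp only [map_add, map_smul]⟩
  · rintro ⟨a, b, hb, rfl⟩
    exact ⟨a • p + b • v, ⟨a, b, hb, rfl⟩, by simp only [map_add, map_smul]⟩

theorem halfPlane_smul_add_smul {r : ℝ} (hr : 0 < r) (p v : E) (s : ℝ) :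
    halfPlane p (r • v + s • p) = halfPlane p v := by
  ext x
  constructor
  · rintro ⟨a, b, hb, rfl⟩
    exact ⟨a + b * s, b * r, mul_pos hb hr, by module⟩
  · rintro ⟨a, b, hb, rfl⟩
    refine ⟨a - b / r * s, b / r, div_pos hb hr, ?_⟩
    match_scalars <;> field_simp
    ring

end HalfPlane

/-! ## Images of decorated sets -/

section Map

variable {E E' E'' : Type*} [NormedAddCommGroup E] [NormedSpace ℝ E]
  [NormedAddCommGroup E'] [NormedSpace ℝ E'] [NormedAddCommGroup E''] [NormedSpace ℝ E'']

theorem smul_mem_tangentVectors {S : Set E} {q w : E} (c : ℝ) (hw : w ∈ tangentVectors S q) :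
    c • w ∈ tangentVectors S q := by
  obtain ⟨γ, h0, hS, hd⟩ := hw
  have hc : HasDerivAt (fun s : ℝ => c * s) c 0 := by
    simpa only [id_eq, mul_one] using (hasDerivAt_id (0 : ℝ)).const_mul c
  have hc0 : Filter.Tendsto (fun s : ℝ => c * s) (𝓝 0) (𝓝 0) := by
    simpa only [mul_zero] using hc.continuousAt.tendsto
  have hd' : HasDerivAt γ w (c * 0) := by rwa [mul_zero]
  exact ⟨fun s => γ (c * s), (congrArg γ (mul_zero c)).trans h0, hc0.eventually hS,
    hd'.scomp (0 : ℝ) hc⟩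

theorem fderiv_mem_tangentVectors {S : Set E} {q w : E} {φ : E → E'}
    (hφ : DifferentiableAt ℝ φ q) (hw : w ∈ tangentVectors S q) :
    fderiv ℝ φ q w ∈ tangentVectors (φ '' S) (φ q) := by
  obtain ⟨γ, rfl, hS, hd⟩ := hw
  exact ⟨φ ∘ γ, rfl, hS.mono fun s hs => Set.mem_image_of_mem φ hs,
    hφ.hasFDerivAt.comp_hasDerivAt 0 hd⟩

theorem mem_tangentVectors_image_iff (L : E ≃L[ℝ] E') {S : Set E} {q w : E} :
    L w ∈ tangentVectors (L '' S) (L q) ↔ w ∈ tangentVectors S q := by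
  constructor
  · intro h
    have h' := fderiv_mem_tangentVectors (φ := L.symm) L.symm.differentiableAt h
    rwa [L.symm.fderiv, L.symm_image_image, L.symm_apply_apply, ContinuousLinearEquiv.coe_coe,
      L.symm_apply_apply] at h'
  · intro h
    have h' := fderiv_mem_tangentVectors (φ := L) L.differentiableAt h
    rwa [L.fderiv] at h'

theorem fderiv_apply_congr_of_eqOn {S : Set E} {q w : E} {φ ψ : E → E'}
    (hφ : DifferentiableAt ℝ φ q) (hψ : DifferentiableAt ℝ ψ q) (h : Set.EqOn φ ψ S)
    (hw : w ∈ tangentVectors S q) : fderiv ℝ φ q w = fderiv ℝ ψ q w := by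
  obtain ⟨γ, rfl, hS, hd⟩ := hw
  have hφγ := hφ.hasFDerivAt.comp_hasDerivAt 0 hd
  have hψγ := hψ.hasFDerivAt.comp_hasDerivAt 0 hd
  exact hφγ.unique (hψγ.congr_of_eventuallyEq (hS.mono fun s hs => h hs))

theorem fderiv_apply_eq_of_line {φ : E → E'} {q w : E} {v : E'}
    (hφ : DifferentiableAt ℝ φ q) (h : ∀ᶠ s : ℝ in 𝓝 0, φ (q + s • w) = φ q + s • v) :
    fderiv ℝ φ q w = v := by
  rw [← hφ.lineDeriv_eq_fderiv, lineDeriv, Filter.EventuallyEq.deriv_eq h, deriv_const_add,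
    deriv_smul_const differentiableAt_fun_id, deriv_id'', one_smul]

namespace OverlyDecorated

/-- All directing vectors are tangent to the carrier: the part of `IsOrientedLineField` that makes
the image under a map depend only on the restriction of the map to the carrier. -/
def IsTangent (S : OverlyDecorated E) : Prop :=
  ∀ q ∈ S.carrier, S.dir q ⊆ tangentVectors S.carrier q

theorem IsOrientedLineField.isTangent {S : OverlyDecorated E} (hS : S.IsOrientedLineField) :
    S.IsTangent := by
  intro q hq w hw
  obtain ⟨w', hw', -, h⟩ := hS.1 q hq
  rw [h] at hw
  obtain ⟨c, -, rfl⟩ := hw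
  exact smul_mem_tangentVectors c hw'

theorem IsOrientedLineField.dir_eq_openRay {S : OverlyDecorated E} (hS : S.IsOrientedLineField)
    {q w : E} (hw : w ∈ S.dir q) : S.dir q = openRay w := by
  have hq : q ∈ S.carrier := by
    by_contra hq
    rwa [hS.2 q hq] at hw
  obtain ⟨w', -, -, h⟩ := hS.1 q hq
  rw [h] at hw
  obtain ⟨c, hc, rfl⟩ := hw
  exact h.trans (openRay_smul hc w').symm

theorem map_map {φ : E → E'} {ψ : E' → E''} (S : OverlyDecorated E)
    (hφ : ∀ q ∈ S.carrier, DifferentiableAt ℝ φ q)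
    (hψ : ∀ q ∈ S.carrier, DifferentiableAt ℝ ψ (φ q)) :
    (S.map φ).map ψ = S.map (ψ ∘ φ) := by
  have chain : ∀ q ∈ S.carrier, ∀ w,
      fderiv ℝ (ψ ∘ φ) q w = fderiv ℝ ψ (φ q) (fderiv ℝ φ q w) := fun q hq w => by
    rw [fderiv_comp q (hψ q hq) (hφ q hq), ContinuousLinearMap.comp_apply]
  ext y x
  · exact iff_of_eq (congrArg (y ∈ ·) (Set.image_comp ψ φ S.carrier).symm)
  · constructor
    · rintro ⟨_, -, rfl, _, ⟨q, hq, rfl, w, hw, rfl⟩, rfl⟩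
      exact ⟨q, hq, rfl, w, hw, (chain q hq w).symm⟩
    · rintro ⟨q, hq, rfl, w, hw, rfl⟩
      exact ⟨φ q, ⟨q, hq, rfl⟩, rfl, _, ⟨q, hq, rfl, w, hw, rfl⟩, chain q hq w⟩

theorem map_congr {φ ψ : E → E'} {S : OverlyDecorated E} (hS : S.IsTangent)
    (hφ : ∀ q ∈ S.carrier, DifferentiableAt ℝ φ q) (hψ : ∀ q ∈ S.carrier, DifferentiableAt ℝ ψ q)
    (h : Set.EqOn φ ψ S.carrier) : S.map φ = S.map ψ := by
  have hd : ∀ q ∈ S.carrier, ∀ w ∈ S.dir q, fderiv ℝ φ q w = fderiv ℝ ψ q w := fun q hq w hw =>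
    fderiv_apply_congr_of_eqOn (hφ q hq) (hψ q hq) h (hS q hq hw)
  ext y x
  · exact iff_of_eq (congrArg (y ∈ ·) (Set.image_congr h))
  · constructor
    · rintro ⟨q, hq, rfl, w, hw, rfl⟩
      exact ⟨q, hq, (h hq).symm, w, hw, hd q hq w hw⟩
    · rintro ⟨q, hq, rfl, w, hw, rfl⟩
      exact ⟨q, hq, h hq, w, hw, (hd q hq w hw).symm⟩

theorem map_id {S : OverlyDecorated E} (hS : ∀ q ∉ S.carrier, S.dir q = ∅) : S.map id = S := by
  ext y x
  · exact iff_of_eq (congrArg (y ∈ ·) (Set.image_id S.carrier))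
  · constructor
    · rintro ⟨q, -, rfl, w, hw, rfl⟩
      rwa [fderiv_id]
    · intro hx
      have hy : y ∈ S.carrier := by
        by_contra hy
        rwa [hS y hy] at hx
      exact ⟨y, hy, rfl, x, hx, by rw [fderiv_id, ContinuousLinearMap.id_apply]⟩

theorem IsOrientedLineField.map_eq_self {φ : E → E} {S : OverlyDecorated E}
    (hS : S.IsOrientedLineField) (hφ : ∀ q ∈ S.carrier, DifferentiableAt ℝ φ q)
    (h : Set.EqOn φ id S.carrier) : S.map φ = S := by
  rw [map_congr hS.isTangent hφ (fun q _ => differentiableAt_id) h, map_id hS.2]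

theorem map_dir_of_injOn {φ : E → E'} {S : OverlyDecorated E} (h : Set.InjOn φ S.carrier)
    {q : E} (hq : q ∈ S.carrier) : (S.map φ).dir (φ q) = fderiv ℝ φ q '' S.dir q := by
  ext x
  constructor
  · rintro ⟨q', hq', he, w, hw, rfl⟩
    obtain rfl := h hq' hq he
    exact ⟨w, hw, rfl⟩
  · rintro ⟨w, hw, rfl⟩
    exact ⟨q, hq, rfl, w, hw, rfl⟩

theorem IsOrientedLineField.map {φ : E → E'} {ψ : E' → E} {S : OverlyDecorated E}
    (hS : S.IsOrientedLineField) (hφ : ∀ q ∈ S.carrier, DifferentiableAt ℝ φ q)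
    (hψ : ∀ q ∈ S.carrier, DifferentiableAt ℝ ψ (φ q)) (h : Set.LeftInvOn ψ φ S.carrier) :
    (S.map φ).IsOrientedLineField := by
  constructor
  · rintro _ ⟨q, hq, rfl⟩
    obtain ⟨w, hw, hw0, hdir⟩ := hS.1 q hq
    refine ⟨fderiv ℝ φ q w, fderiv_mem_tangentVectors (hφ q hq) hw, fun h0 => hw0 ?_, ?_⟩
    · have left_inv : fderiv ℝ (ψ ∘ φ) q w = fderiv ℝ id q w :=
        fderiv_apply_congr_of_eqOn ((hψ q hq).comp q (hφ q hq)) differentiableAt_id h hw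
      rw [fderiv_comp q (hψ q hq) (hφ q hq), ContinuousLinearMap.comp_apply, h0, map_zero,
        fderiv_id, ContinuousLinearMap.id_apply] at left_inv
      exact left_inv.symm
    · rw [map_dir_of_injOn h.injOn hq, hdir]
      exact image_openRay (fderiv ℝ φ q).toLinearMap w
  · intro y hy
    refine Set.eq_empty_iff_forall_notMem.2 ?_
    rintro _ ⟨q, hq, rfl, -⟩
    exact hy ⟨q, hq, rfl⟩

end OverlyDecorated

end Map

/-! ## Horospheres in the hyperboloid model -/

section Minkowski

theorem minkInner_comm (x y : Mink) : minkInner x y = minkInner y x := by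
  simp only [minkInner, mul_comm]

theorem minkInner_add_left (x y z : Mink) :
    minkInner (x + y) z = minkInner x z + minkInner y z := by
  simp only [minkInner, Pi.add_apply]; ring

theorem minkInner_add_right (x y z : Mink) :
    minkInner x (y + z) = minkInner x y + minkInner x z := by
  simp only [minkInner, Pi.add_apply]; ring

theorem minkInner_smul_left (r : ℝ) (x y : Mink) : minkInner (r • x) y = r * minkInner x y := by
  simp only [minkInner, Pi.smul_apply, smul_eq_mul]; ring

theorem minkInner_smul_right (r : ℝ) (x y : Mink) : minkInner x (r • y) = r * minkInner x y := by
  simp only [minkInner, Pi.smul_apply, smul_eq_mul]; ring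

theorem hasDerivAt_minkInner {γ δ : ℝ → Mink} {v w : Mink} {s : ℝ} (hγ : HasDerivAt γ v s)
    (hδ : HasDerivAt δ w s) :
    HasDerivAt (fun s => minkInner (γ s) (δ s)) (minkInner v (δ s) + minkInner (γ s) w) s := by
  have h := fun i => (hasDerivAt_pi.1 hγ i).mul (hasDerivAt_pi.1 hδ i)
  convert! (((h 0).sub (h 1)).sub (h 2)).sub (h 3) using 1
  simp only [minkInner]; ring

theorem minkInner_eq_zero_of_mem_tangentVectors {S : Set Mink} {x v : Mink} {c : ℝ}
    (hS : ∀ y ∈ S, minkInner y y = c) (hv : v ∈ tangentVectors S x) : minkInner v x = 0 := by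
  obtain ⟨γ, rfl, hγ, hd⟩ := hv
  have h := (hasDerivAt_minkInner hd hd).unique
    ((hasDerivAt_const (0 : ℝ) c).congr_of_eventuallyEq (hγ.mono fun s hs => hS _ hs))
  rw [minkInner_comm (γ 0)] at h
  linarith

theorem minkInner_eq_zero_of_mem_tangentVectors_lightCone {p v : Mink}
    (hv : v ∈ tangentVectors lightCone p) : minkInner v p = 0 :=
  minkInner_eq_zero_of_mem_tangentVectors (fun _ hy => hy.1) hv

theorem minkInner_pos {x p : Mink} (hx : x ∈ hyperboloid) (hp : p ∈ lightCone) :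
    0 < minkInner x p := by
  obtain ⟨hxx, hx0⟩ := hx
  obtain ⟨hpp, hp0⟩ := hp
  simp only [minkInner] at *
  have cauchy_schwarz : (x 1 * p 1 + x 2 * p 2 + x 3 * p 3) ^ 2 ≤
      (x 1 ^ 2 + x 2 ^ 2 + x 3 ^ 2) * (p 1 ^ 2 + p 2 ^ 2 + p 3 ^ 2) := by
    nlinarith [sq_nonneg (x 1 * p 2 - x 2 * p 1), sq_nonneg (x 1 * p 3 - x 3 * p 1),
      sq_nonneg (x 2 * p 3 - x 3 * p 2)]
  have hx' : x 1 ^ 2 + x 2 ^ 2 + x 3 ^ 2 = x 0 ^ 2 - 1 := by linarith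
  have hp' : p 1 ^ 2 + p 2 ^ 2 + p 3 ^ 2 = p 0 ^ 2 := by linarith
  rw [hx', hp'] at cauchy_schwarz
  have := lt_of_pow_lt_pow_left₀ 2 (mul_pos hx0 hp0).le
    (cauchy_schwarz.trans_lt (b := (x 0 ^ 2 - 1) * p 0 ^ 2) (by nlinarith))
  linarith

/-- The time orientation of `x` is detected by `2 T(x) = ⟨x, n⟩ + ⟨x, n'⟩` for the null vectors
`n, n' = (1, 0, 0, ±1)`. -/
theorem mapsTo_hyperboloid_of_surjOn_lightCone {L : Mink → Mink}
    (hL : ∀ x y, minkInner (L x) (L y) = minkInner x y) (hc : Set.SurjOn L lightCone lightCone) :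
    Set.MapsTo L hyperboloid hyperboloid := by
  intro x hx
  have pos : ∀ p ∈ lightCone, 0 < minkInner (L x) p := fun p hp => by
    obtain ⟨q, hq, rfl⟩ := hc hp
    rw [hL]
    exact minkInner_pos hx hq
  have h₁ := pos ![1, 0, 0, 1] (by simp [lightCone, minkInner])
  have h₂ := pos ![1, 0, 0, -1] (by simp [lightCone, minkInner])
  simp only [minkInner, Matrix.cons_val] at h₁ h₂
  exact ⟨(hL x x).trans hx.1, by linarith⟩

theorem mem_tangentVectors_horosphere {p x w : Mink} (hp : minkInner p p = 0)
    (hx : x ∈ hyperboloid) (hxp : minkInner x p = 1) :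
    w ∈ tangentVectors {x | x ∈ hyperboloid ∧ minkInner x p = 1} x ↔
      minkInner w x = 0 ∧ minkInner w p = 0 := by
  constructor
  · intro hw
    refine ⟨minkInner_eq_zero_of_mem_tangentVectors (fun y hy => hy.1.1) hw, ?_⟩
    obtain ⟨γ, rfl, hγ, hd⟩ := hw
    have h := (hasDerivAt_minkInner hd (hasDerivAt_const (0 : ℝ) p)).unique
      ((hasDerivAt_const (0 : ℝ) (1 : ℝ)).congr_of_eventuallyEq (hγ.mono fun s hs => hs.2))
    simpa [minkInner] using h
  · rintro ⟨hwx, hwp⟩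
    -- Moving along `w` leaves the hyperboloid to second order; a multiple of `p` corrects this.
    let γ : ℝ → Mink := fun s => x + s • w + (s ^ 2 * (-minkInner w w / 2)) • p
    have hγ : HasDerivAt γ w 0 := by
      have linear_part := ((hasDerivAt_id (0 : ℝ)).smul_const w).const_add x
      have correction :=
        (((hasDerivAt_id (0 : ℝ)).pow 2).mul_const (-minkInner w w / 2)).smul_const p
      convert! linear_part.add correction using 1
      simp
    have hpos : ∀ᶠ s in 𝓝 (0 : ℝ), 0 < γ s 0 :=
      ((continuous_apply 0).continuousAt.comp hγ.continuousAt).eventually_const_lt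
        (by simpa [γ] using hx.2)
    refine ⟨γ, by simp [γ], hpos.mono fun s hs => ⟨⟨?_, hs⟩, ?_⟩, hγ⟩
    · simp only [γ, minkInner_add_right, minkInner_add_left, minkInner_smul_right,
        minkInner_smul_left, minkInner_comm p, minkInner_comm x w, hwx, hwp, hp, hxp, hx.1]
      ring
    · simp only [γ, minkInner_add_left, minkInner_smul_left, hwp, hp, hxp]
      ring

theorem mem_mapH_carrier {P : NullFlag lightCone} {x : Mink} :
    x ∈ (mapH P).carrier ↔ x ∈ hyperboloid ∧ minkInner x P.point = 1 := Iff.rfl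

theorem mapH_dir {P : NullFlag lightCone} {v x : Mink} (hv : minkInner v P.point = 0)
    (hP : P.pos = halfPlane P.point v) (hx : x ∈ (mapH P).carrier) :
    (mapH P).dir x = openRay (v - minkInner v x • P.point) := by
  obtain ⟨hxH, hxp⟩ := hx
  have hp := P.point_mem.1
  have hpx : minkInner P.point x = 1 := by rw [minkInner_comm, hxp]
  ext w
  constructor
  · rintro ⟨-, -, hw, hwt⟩
    rw [hP] at hw
    obtain ⟨a, b, hb, rfl⟩ := hw
    have h := ((mem_tangentVectors_horosphere hp hxH hxp).1 hwt).1
    rw [minkInner_add_left, minkInner_smul_left, minkInner_smul_left, hpx, mul_one] at h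
    rw [eq_neg_of_add_eq_zero_left h]
    exact ⟨b, hb, by module⟩
  · rintro ⟨c, hc, rfl⟩
    refine ⟨hxH, hxp, ?_, (mem_tangentVectors_horosphere hp hxH hxp).2 ?_⟩
    · rw [hP]
      exact ⟨-(c * minkInner v x), c, hc, by module⟩
    · simp only [sub_eq_add_neg, ← neg_smul, minkInner_smul_left, minkInner_add_left, hv, hp, hpx]
      constructor <;> ring

theorem isOrientedLineField_mapH (P : NullFlag lightCone) : (mapH P).IsOrientedLineField := by
  obtain ⟨v, hv, hli, -, hpos⟩ := P.spanned
  have hvp := minkInner_eq_zero_of_mem_tangentVectors_lightCone hv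
  refine ⟨fun x hx => ⟨v - minkInner v x • P.point, ?_, fun h0 => ?_, mapH_dir hvp hpos hx⟩,
    fun x hx => Set.eq_empty_iff_forall_notMem.2 fun w hw => hx ⟨hw.1, hw.2.1⟩⟩
  · have hw := self_mem_openRay (v - minkInner v x • P.point)
    rw [← mapH_dir hvp hpos hx] at hw
    exact hw.2.2.2
  · have h := LinearIndependent.pair_iff.1 hli (-minkInner v x) 1 (by rw [← h0]; module)
    exact one_ne_zero h.2

theorem mapH_map {P Q : NullFlag lightCone} (L : Mink ≃L[ℝ] Mink)
    (hL : ∀ x y, minkInner (L x) (L y) = minkInner x y)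
    (hhyp : ∀ x, L x ∈ hyperboloid ↔ x ∈ hyperboloid)
    (hpoint : Q.point = L P.point) (hpos : Q.pos = L '' P.pos) : (mapH P).map L = mapH Q := by
  have hcarrier : L '' (mapH P).carrier = (mapH Q).carrier := by
    ext y
    obtain ⟨x, rfl⟩ := L.surjective y
    rw [L.injective.mem_set_image, mem_mapH_carrier, mem_mapH_carrier, hhyp, hpoint, hL]
  ext y w
  · exact iff_of_eq (congrArg (y ∈ ·) hcarrier)
  obtain ⟨x, rfl⟩ := L.surjective y
  obtain ⟨w, rfl⟩ := L.surjective w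
  have htangent : L w ∈ tangentVectors (mapH Q).carrier (L x) ↔
      w ∈ tangentVectors (mapH P).carrier x := by
    rw [← hcarrier, mem_tangentVectors_image_iff]
  constructor
  · rintro ⟨x', -, hx', w', ⟨hx, hxp, hw, hwt⟩, hw'⟩
    rw [L.fderiv] at hw'
    obtain rfl := L.injective hx'
    obtain rfl := L.injective hw'
    exact ⟨(hhyp x').2 hx, by rwa [hpoint, hL], hpos ▸ Set.mem_image_of_mem L hw, htangent.2 hwt⟩
  · rintro ⟨hx, hxp, hw, hwt⟩
    rw [hhyp] at hx
    rw [hpoint, hL] at hxp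
    rw [hpos, L.injective.mem_set_image] at hw
    exact ⟨x, ⟨hx, hxp⟩, rfl, w, ⟨hx, hxp, hw, htangent.1 hwt⟩, by rw [L.fderiv]; rfl⟩

end Minkowski

/-! ## The null vector and the flag vector of a spinor -/

section SpinorVectors

/-- The null vector `g(f(κ))`, the point of the flag `G(F(κ))`. -/
def nullVec (κ : Fin 2 → ℂ) : Mink := hermEquiv (spinorSq κ)

/-- The flag vector `g(D_κ f(Z κ))`, which spans the plane of the flag `G(F(κ))` together with the
null vector. -/
def flagVec (κ : Fin 2 → ℂ) : Mink := hermEquiv (spinorSqDeriv κ (spinorZ κ))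

theorem nullVec_eq (κ : Fin 2 → ℂ) : nullVec κ =
    ![(κ 0).re ^ 2 + (κ 0).im ^ 2 + (κ 1).re ^ 2 + (κ 1).im ^ 2,
      2 * ((κ 0).re * (κ 1).re + (κ 0).im * (κ 1).im),
      2 * ((κ 0).im * (κ 1).re - (κ 0).re * (κ 1).im),
      (κ 0).re ^ 2 + (κ 0).im ^ 2 - (κ 1).re ^ 2 - (κ 1).im ^ 2] := by
  ext i
  fin_cases i <;> simp [nullVec, hermEquiv, spinorSq_apply] <;> ring

theorem flagVec_eq (κ : Fin 2 → ℂ) : flagVec κ =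
    ![0, -4 * ((κ 0).re * (κ 0).im - (κ 1).re * (κ 1).im),
      2 * ((κ 0).re ^ 2 - (κ 0).im ^ 2 + (κ 1).re ^ 2 - (κ 1).im ^ 2),
      4 * ((κ 0).re * (κ 1).im + (κ 0).im * (κ 1).re)] := by
  ext i
  fin_cases i <;> simp [flagVec, hermEquiv, spinorSqDeriv_apply, spinorZ] <;> ring

theorem nullVec_mem_lightCone {κ : Fin 2 → ℂ} (hκ : κ ≠ 0) : nullVec κ ∈ lightCone :=
  hermEquiv_mem_lightCone (spinorSq_mem_hermCone hκ)

theorem minkInner_nullVec_self (κ : Fin 2 → ℂ) : minkInner (nullVec κ) (nullVec κ) = 0 := by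
  simp only [minkInner, nullVec_eq, Matrix.cons_val]; ring

theorem minkInner_flagVec_nullVec (κ : Fin 2 → ℂ) : minkInner (flagVec κ) (nullVec κ) = 0 := by
  simp only [minkInner, nullVec_eq, flagVec_eq, Matrix.cons_val]; ring

theorem minkInner_flagVec_self (κ : Fin 2 → ℂ) :
    minkInner (flagVec κ) (flagVec κ) = -(2 * nullVec κ 0) ^ 2 := by
  simp only [minkInner, nullVec_eq, flagVec_eq, Matrix.cons_val]; ring

theorem nullVec_smul (l : ℂ) (κ : Fin 2 → ℂ) :
    nullVec (l • κ) = Complex.normSq l • nullVec κ := by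
  rw [nullVec, nullVec, ← map_smul]
  congr 1
  ext i j
  simp only [spinorSq_apply, Pi.smul_apply, smul_eq_mul, star_mul', Complex.star_def,
    selfAdjoint.val_smul, Matrix.smul_apply, Complex.real_smul, Complex.normSq_eq_conj_mul_self]
  ring

theorem flagVec_smul (l : ℂ) (κ : Fin 2 → ℂ) :
    nullVec κ 0 • Matrix.vecTail (flagVec (l • κ)) =
      ((l ^ 2).re * nullVec κ 0) • Matrix.vecTail (flagVec κ) +
        (l ^ 2).im • (Matrix.vecTail (nullVec κ) ⨯₃ Matrix.vecTail (flagVec κ)) := by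
  ext i
  fin_cases i <;>
    simp [nullVec_eq, flagVec_eq, cross_apply, Matrix.vecTail, pow_two] <;> ring

/-- The spinor is, up to a real factor, a nonzero column of the Hermitian matrix of `p`. -/
theorem exists_nullVec_eq {p : Mink} (hp : p ∈ lightCone) : ∃ κ ≠ 0, nullVec κ = p := by
  obtain ⟨hpp, hp0⟩ := hp
  obtain ⟨κ, c, hc, hκ⟩ : ∃ (κ : Fin 2 → ℂ) (c : ℝ), 0 < c ∧ nullVec κ = c • p := by
    simp only [minkInner] at hpp
    rcases le_total (p 3) 0 with h3 | h3
    · refine ⟨![⟨p 1, p 2⟩, ((p 0 - p 3 : ℝ) : ℂ)], 2 * (p 0 - p 3), by linarith, ?_⟩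
      ext i
      fin_cases i <;> simp only [nullVec_eq, Fin.reduceFinMk, Matrix.cons_val, Pi.smul_apply,
        smul_eq_mul, Complex.ofReal_re, Complex.ofReal_im]
      · linear_combination -hpp
      · ring
      · ring
      · linear_combination -hpp
    · refine ⟨![((p 0 + p 3 : ℝ) : ℂ), ⟨p 1, -p 2⟩], 2 * (p 0 + p 3), by linarith, ?_⟩
      ext i
      fin_cases i <;> simp only [nullVec_eq, Fin.reduceFinMk, Matrix.cons_val, Pi.smul_apply,
        smul_eq_mul, Complex.ofReal_re, Complex.ofReal_im]
      · linear_combination -hpp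
      · ring
      · ring
      · linear_combination hpp
  have hl : Complex.normSq ((√c)⁻¹ : ℝ) * c = 1 := by
    rw [Complex.normSq_ofReal, ← mul_inv, Real.mul_self_sqrt hc.le, inv_mul_cancel₀ hc.ne']
  have hν : nullVec (((√c)⁻¹ : ℂ) • κ) = p := by
    rw [← Complex.ofReal_inv, nullVec_smul, hκ, smul_smul, hl, one_smul]
  refine ⟨_, fun h0 => hp0.ne' ?_, hν⟩
  rw [← hν, h0]
  simp [nullVec_eq]

theorem exists_eq_smul_of_nullVec_eq {κ μ : Fin 2 → ℂ} (hκ : κ ≠ 0)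
    (h : nullVec μ = nullVec κ) : ∃ l : ℂ, Complex.normSq l = 1 ∧ μ = l • κ := by
  have hsq : ∀ i j, μ i * star (μ j) = κ i * star (κ j) := fun i j => by
    rw [← spinorSq_apply, hermEquiv.injective h, spinorSq_apply]
  have hn : κ 0 * star (κ 0) + κ 1 * star (κ 1) ≠ 0 := fun h0 => by
    have hT := (nullVec_mem_lightCone hκ).2
    have h0' := congrArg Complex.re h0
    simp only [Complex.add_re, Complex.star_def, Complex.mul_conj, Complex.ofReal_re,
      Complex.normSq_apply, Complex.zero_re] at h0'
    simp only [nullVec_eq, Matrix.cons_val] at hT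
    linarith
  set l := (μ 0 * star (κ 0) + μ 1 * star (κ 1)) / (κ 0 * star (κ 0) + κ 1 * star (κ 1)) with hl
  have hμ : μ = l • κ := by
    ext i
    rw [Pi.smul_apply, smul_eq_mul, hl, div_mul_eq_mul_div, eq_div_iff hn]
    linear_combination μ 0 * hsq i 0 + μ 1 * hsq i 1 - μ i * hsq 0 0 - μ i * hsq 1 1
  refine ⟨l, ?_, hμ⟩
  rw [hμ, nullVec_smul] at h
  have h0 := congrFun h 0
  rw [Pi.smul_apply, smul_eq_mul] at h0
  exact (mul_eq_right₀ (nullVec_mem_lightCone hκ).2.ne').1 h0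

end SpinorVectors

/-! ## The coordinates of a spinor -/

section Coordinates

theorem minkInner_eq_sub_dotProduct (x y : Mink) :
    minkInner x y = x 0 * y 0 - Matrix.vecTail x ⬝ᵥ Matrix.vecTail y := by
  simp only [minkInner, Matrix.vecTail, Matrix.vec3_dotProduct, Function.comp_apply,
    Fin.succ_zero_eq_one, Fin.succ_one_eq_two, show (2 : Fin 3).succ = 3 from rfl]
  ring

theorem eq_smul_add_smul_cross {R : Type*} [CommRing R] {u a v : Fin 3 → R} (hu : u ⬝ᵥ u = 1)
    (ha : a ⬝ᵥ a = 1) (hua : u ⬝ᵥ a = 0) (huv : u ⬝ᵥ v = 0) :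
    v = (a ⬝ᵥ v) • a + ((u ⨯₃ a) ⬝ᵥ v) • (u ⨯₃ a) := by
  have gram : ((u ⨯₃ a) ⬝ᵥ v) • (u ⨯₃ a) = (u ⬝ᵥ u) • ((a ⬝ᵥ a) • v - (a ⬝ᵥ v) • a) -
      (u ⬝ᵥ a) • ((u ⬝ᵥ a) • v - (a ⬝ᵥ v) • u) + (u ⬝ᵥ v) • ((u ⬝ᵥ a) • a - (a ⬝ᵥ a) • u) := by
    ext i
    fin_cases i <;> simp [cross_apply, Matrix.vec3_dotProduct, Matrix.vecHead,
      Matrix.vecTail] <;> ring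
  rw [gram, hu, ha, hua, huv]
  module

/-- The point of the sphere at infinity on the null ray of a spinor. -/
def boundaryPoint (κ : Fin 2 → ℂ) : R3 := (nullVec κ 0)⁻¹ • Matrix.vecTail (nullVec κ)

/-- The direction of the flag of a spinor, as a unit tangent vector to the sphere at infinity. -/
def flagDirection (κ : Fin 2 → ℂ) : R3 := (2 * nullVec κ 0)⁻¹ • Matrix.vecTail (flagVec κ)

theorem nullVec_zero_pos {κ : Fin 2 → ℂ} (hκ : κ ≠ 0) : 0 < nullVec κ 0 :=
  (nullVec_mem_lightCone hκ).2

theorem nullVec_eq_smul_vecCons {κ : Fin 2 → ℂ} (hκ : κ ≠ 0) :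
    nullVec κ = nullVec κ 0 • Matrix.vecCons 1 (boundaryPoint κ) := by
  rw [boundaryPoint, Matrix.smul_cons, smul_inv_smul₀ (nullVec_zero_pos hκ).ne', smul_eq_mul,
    mul_one]
  exact (Matrix.cons_head_tail _).symm

theorem flagVec_eq_smul_vecCons {κ : Fin 2 → ℂ} (hκ : κ ≠ 0) :
    flagVec κ = (2 * nullVec κ 0) • Matrix.vecCons 0 (flagDirection κ) := by
  have h0 : flagVec κ 0 = 0 := by rw [flagVec_eq, Matrix.cons_val_zero]
  rw [flagDirection, Matrix.smul_cons,
    smul_inv_smul₀ (mul_ne_zero two_ne_zero (nullVec_zero_pos hκ).ne'), smul_zero, ← h0]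
  exact (Matrix.cons_head_tail _).symm

theorem boundaryPoint_dotProduct_self {κ : Fin 2 → ℂ} (hκ : κ ≠ 0) :
    boundaryPoint κ ⬝ᵥ boundaryPoint κ = 1 := by
  have hT := (nullVec_zero_pos hκ).ne'
  have h := minkInner_nullVec_self κ
  rw [minkInner_eq_sub_dotProduct, sub_eq_zero] at h
  rw [boundaryPoint, smul_dotProduct, dotProduct_smul, ← h, smul_eq_mul, smul_eq_mul]
  field_simp

theorem flagDirection_dotProduct_self {κ : Fin 2 → ℂ} (hκ : κ ≠ 0) :
    flagDirection κ ⬝ᵥ flagDirection κ = 1 := by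
  have hT := (nullVec_zero_pos hκ).ne'
  have h := minkInner_flagVec_self κ
  have h0 : flagVec κ 0 = 0 := by rw [flagVec_eq, Matrix.cons_val_zero]
  rw [minkInner_eq_sub_dotProduct, h0, mul_zero, zero_sub, neg_inj] at h
  rw [flagDirection, smul_dotProduct, dotProduct_smul, h, smul_eq_mul, smul_eq_mul]
  field_simp

theorem boundaryPoint_dotProduct_flagDirection (κ : Fin 2 → ℂ) :
    boundaryPoint κ ⬝ᵥ flagDirection κ = 0 := by
  have h := minkInner_flagVec_nullVec κ
  have h0 : flagVec κ 0 = 0 := by rw [flagVec_eq, Matrix.cons_val_zero]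
  rw [minkInner_eq_sub_dotProduct, h0, zero_mul, zero_sub, neg_eq_zero] at h
  rw [boundaryPoint, flagDirection, smul_dotProduct, dotProduct_smul, dotProduct_comm, h,
    smul_zero, smul_zero]

theorem boundaryPoint_eq_of_nullVec_eq {κ : Fin 2 → ℂ} {r : ℝ} {u : R3} (hr : r ≠ 0)
    (h : nullVec κ = r • Matrix.vecCons 1 u) : boundaryPoint κ = u := by
  have h0 : nullVec κ 0 = r := by rw [h, Pi.smul_apply, Matrix.cons_val_zero, smul_eq_mul, mul_one]
  rw [boundaryPoint, h0, h]
  exact inv_smul_smul₀ hr u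

theorem flagDirection_smul {κ : Fin 2 → ℂ} (hκ : κ ≠ 0) {l : ℂ} (hl : Complex.normSq l = 1) :
    flagDirection (l • κ) = (l ^ 2).re • flagDirection κ +
      (l ^ 2).im • (boundaryPoint κ ⨯₃ flagDirection κ) := by
  have hT := (nullVec_zero_pos hκ).ne'
  have h := congrArg ((2 * nullVec κ 0 * nullVec κ 0)⁻¹ • ·) (flagVec_smul l κ)
  simp only [smul_add, smul_smul] at h
  rw [flagDirection, nullVec_smul, hl, one_smul, boundaryPoint, flagDirection, map_smul,
    map_smul, LinearMap.smul_apply, smul_smul, smul_smul, smul_smul]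
  convert! h using 2
  · field_simp
  · congr 1; field_simp
  · congr 1; field_simp

theorem normSq_sq_eq_one {l : ℂ} (hl : Complex.normSq l = 1) :
    (l ^ 2).re ^ 2 + (l ^ 2).im ^ 2 = 1 := by
  have h := map_pow Complex.normSq l 2
  rw [hl, one_pow, Complex.normSq_apply] at h
  linear_combination h

/-- The coordinates in `UTS² × ℝ` of a spinor: the null ray, the direction of the flag, and the
logarithm of the time component of the null vector. -/
def coords (κ : Spinor) : UTS2 × ℝ :=
  (⟨(boundaryPoint κ, flagDirection κ), boundaryPoint_dotProduct_self κ.ne_zero,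
    flagDirection_dotProduct_self κ.ne_zero, boundaryPoint_dotProduct_flagDirection κ⟩,
    Real.log (nullVec κ 0))

theorem modSign_eq_iff {κ μ : Spinor} :
    modSign κ = modSign μ ↔ (μ : Fin 2 → ℂ) = κ ∨ (μ : Fin 2 → ℂ) = -κ := by
  rw [eq_comm, modSign, modSign, Quotient.eq, MulAction.orbitRel_apply, MulAction.mem_orbit_iff]
  constructor
  · rintro ⟨e, rfl⟩
    rcases Int.units_eq_one_or e with rfl | rfl
    · exact Or.inl (congrArg _ (one_smul ℤˣ κ))
    · exact Or.inr κ.coe_neg_one_smul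
  · rintro (h | h)
    · exact ⟨1, by rw [one_smul, Subtype.ext h]⟩
    · exact ⟨-1, Subtype.ext (κ.coe_neg_one_smul.trans h.symm)⟩

theorem coords_eq_iff {κ μ : Spinor} : coords κ = coords μ ↔ modSign κ = modSign μ := by
  rw [modSign_eq_iff]
  constructor
  · intro h
    have hu : boundaryPoint κ = boundaryPoint μ := congrArg (fun x => x.1.1.1) h
    have hv : flagDirection κ = flagDirection μ := congrArg (fun x => x.1.1.2) h
    have hT : nullVec κ 0 = nullVec μ 0 := Real.log_injOn_pos (nullVec_zero_pos κ.ne_zero)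
      (nullVec_zero_pos μ.ne_zero) (congrArg Prod.snd h)
    have hp : nullVec μ = nullVec κ := by
      rw [nullVec_eq_smul_vecCons κ.ne_zero, nullVec_eq_smul_vecCons μ.ne_zero, hu, hT]
    obtain ⟨l, hl, hμ⟩ := exists_eq_smul_of_nullVec_eq κ.ne_zero hp
    have hre : (l ^ 2).re = 1 := by
      have h := congrArg (flagDirection κ ⬝ᵥ ·) (flagDirection_smul κ.ne_zero hl)
      simpa only [← hμ, ← hv, dotProduct_add, dotProduct_smul, dot_cross_self,
        flagDirection_dotProduct_self κ.ne_zero, smul_eq_mul, mul_one, mul_zero, add_zero]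
        using h.symm
    have him : (l ^ 2).im = 0 := by
      have h := normSq_sq_eq_one hl
      rwa [hre, one_pow, add_eq_left, sq_eq_zero_iff] at h
    have hl2 : l * l = 1 := by rw [← sq]; exact Complex.ext hre him
    rcases mul_self_eq_one_iff.1 hl2 with rfl | rfl
    · exact Or.inl (by rw [hμ, one_smul])
    · exact Or.inr (by rw [hμ, neg_one_smul])
  · rintro (h | h)
    · rw [Subtype.ext h]
    · have hp : nullVec μ = nullVec κ := by rw [h, ← neg_one_smul ℂ, nullVec_smul]; simp
      have hw : flagVec μ = flagVec κ := by rw [h, flagVec_eq, flagVec_eq]; simp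
      simp only [coords, boundaryPoint, flagDirection, hp, hw]

theorem coords_surjective : Function.Surjective coords := by
  rintro ⟨⟨⟨u, v⟩, hu, hv, huv⟩, t⟩
  have hp : Real.exp t • Matrix.vecCons 1 u ∈ lightCone := by
    refine ⟨?_, ?_⟩
    · rw [minkInner_smul_left, minkInner_smul_right, minkInner_eq_sub_dotProduct, Matrix.tail_cons,
        hu, Matrix.cons_val_zero, mul_one, sub_self, mul_zero, mul_zero]
    · rw [Pi.smul_apply, Matrix.cons_val_zero, smul_eq_mul, mul_one]
      exact Real.exp_pos t
  obtain ⟨κ, hκ, hκp⟩ := exists_nullVec_eq hp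
  have hκu := boundaryPoint_eq_of_nullVec_eq (Real.exp_pos t).ne' hκp
  set a := flagDirection κ
  have expansion := eq_smul_add_smul_cross hu (flagDirection_dotProduct_self hκ)
    (hκu ▸ boundaryPoint_dotProduct_flagDirection κ) huv
  have hcs : (a ⬝ᵥ v) ^ 2 + ((u ⨯₃ a) ⬝ᵥ v) ^ 2 = 1 := by
    have h := congrArg (· ⬝ᵥ v) expansion
    simp only [add_dotProduct, smul_dotProduct, smul_eq_mul, hv] at h
    linear_combination -h
  obtain ⟨l, hl⟩ := IsAlgClosed.exists_pow_nat_eq (⟨a ⬝ᵥ v, (u ⨯₃ a) ⬝ᵥ v⟩ : ℂ) two_pos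
  have hl1 : Complex.normSq l = 1 := by
    have h := map_pow Complex.normSq l 2
    rw [hl, Complex.normSq_mk, ← sq, ← sq, hcs] at h
    exact (pow_eq_one_iff_of_nonneg (Complex.normSq_nonneg l) two_ne_zero).1 h.symm
  have hl0 : l ≠ 0 := by
    rintro rfl
    simp at hl1
  have hlp : nullVec (l • κ) = Real.exp t • Matrix.vecCons 1 u := by
    rw [nullVec_smul, hl1, one_smul, hκp]
  refine ⟨⟨l • κ, smul_ne_zero hl0 hκ⟩, Prod.ext (Subtype.ext (Prod.ext ?_ ?_)) ?_⟩
  · exact boundaryPoint_eq_of_nullVec_eq (Real.exp_pos t).ne' hlp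
  · change flagDirection (l • κ) = v
    rw [flagDirection_smul hκ hl1, hl, hκu]
    exact expansion.symm
  · change Real.log (nullVec (l • κ) 0) = t
    rw [hlp, Pi.smul_apply, Matrix.cons_val_zero, smul_eq_mul, mul_one, Real.log_exp]

/-- A surjective map on spinors whose fibres are the pairs `{κ, -κ}`, as a bijection from spinors up
to sign. -/
def modSignEquiv {α : Type*} (f : Spinor → α) (hf : Function.Surjective f)
    (h : ∀ κ μ, f κ = f μ ↔ modSign κ = modSign μ) : SpinorModSign ≃ α :=
  (Quotient.congrRight (r' := Setoid.ker f) fun κ μ =>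
    (Quotient.eq.symm : _ ↔ modSign κ = modSign μ).trans (h κ μ).symm).trans
    (Setoid.quotientKerEquivOfSurjective f hf)

theorem modSignEquiv_modSign {α : Type*} {f : Spinor → α} (hf : Function.Surjective f)
    (h : ∀ κ μ, f κ = f μ ↔ modSign κ = modSign μ) (κ : Spinor) :
    modSignEquiv f hf h (modSign κ) = f κ := rfl

/-- The coordinates of spinors up to sign. -/
def coordsEquiv : SpinorModSign ≃ UTS2 × ℝ :=
  modSignEquiv coords coords_surjective fun _ _ => coords_eq_iff

theorem coordsEquiv_modSign (κ : Spinor) : coordsEquiv (modSign κ) = coords κ :=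
  modSignEquiv_modSign _ _ κ

end Coordinates

section Smoothness

@[fun_prop]
theorem contDiff_re_comp {E : Type*} [NormedAddCommGroup E] [NormedSpace ℝ E] {n : WithTop ℕ∞}
    {f : E → ℂ} (hf : ContDiff ℝ n f) : ContDiff ℝ n fun x => (f x).re :=
  Complex.reCLM.contDiff.comp hf

@[fun_prop]
theorem contDiff_im_comp {E : Type*} [NormedAddCommGroup E] [NormedSpace ℝ E] {n : WithTop ℕ∞}
    {f : E → ℂ} (hf : ContDiff ℝ n f) : ContDiff ℝ n fun x => (f x).im :=
  Complex.imCLM.contDiff.comp hf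

theorem contDiff_nullVec : ContDiff ℝ ∞ nullVec := by
  refine contDiff_pi.2 fun i => ?_
  simp only [nullVec_eq]
  fin_cases i <;> simp only [Fin.reduceFinMk, Matrix.cons_val] <;> fun_prop

theorem contDiff_flagVec : ContDiff ℝ ∞ flagVec := by
  refine contDiff_pi.2 fun i => ?_
  simp only [flagVec_eq]
  fin_cases i <;> simp only [Fin.reduceFinMk, Matrix.cons_val] <;> fun_prop

theorem smoothToUTS2_coords : SmoothToUTS2 coords := by
  intro κ
  have hT := (nullVec_zero_pos κ.ne_zero).ne'
  have h0 : ContDiffAt ℝ ∞ (fun κ => nullVec κ 0) κ := (contDiff_pi.1 contDiff_nullVec 0).contDiffAt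
  have vecTail : ∀ {V : (Fin 2 → ℂ) → Mink}, ContDiff ℝ ∞ V →
      ContDiffAt ℝ ∞ (fun κ => Matrix.vecTail (V κ)) κ := fun hV =>
    contDiffAt_pi.2 fun i => (contDiff_pi.1 hV i.succ).contDiffAt
  have hu : ContDiffAt ℝ ∞ boundaryPoint κ := (h0.inv hT).smul (vecTail contDiff_nullVec)
  have hv : ContDiffAt ℝ ∞ flagDirection κ :=
    ((contDiffAt_const.mul h0).inv (mul_ne_zero two_ne_zero hT)).smul (vecTail contDiff_flagVec)
  exact ((hu.prodMk hv).prodMk (h0.log hT)).contMDiffAt.comp κ (contMDiff_subtype_val κ)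

end Smoothness

section QuotientManifold

variable {G M H E E' : Type*} [Group G] [TopologicalSpace M] [MulAction G M]
  [ProperlyDiscontinuousSMul G M] [ContinuousConstSMul G M] [IsCancelSMul G M] [T2Space M]
  [LocallyCompactSpace M] [TopologicalSpace H] [ChartedSpace H M]
  {𝕜 : Type*} [NontriviallyNormedField 𝕜] [NormedAddCommGroup E] [NormedSpace 𝕜 E]
  [NormedAddCommGroup E'] [NormedSpace 𝕜 E'] {I : ModelWithCorners 𝕜 E H} {n : WithTop ℕ∞}

theorem contMDiff_of_comp_quotientMk {f : MulAction.orbitRel.Quotient G M → E'}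
    (hf : ContMDiff I 𝓘(𝕜, E') n fun x : M => f (Quotient.mk _ x)) : ContMDiff I 𝓘(𝕜, E') n f := by
  intro x
  have hmk : IsLocalHomeomorph (Quotient.mk (MulAction.orbitRel G M)) :=
    isQuotientCoveringMap_quotientMk_of_properlyDiscontinuousSMul.isCoveringMap.isLocalHomeomorph
  have hright := (Quotient.mk_surjective (s := MulAction.orbitRel G M)).hasRightInverse
  set y : M := hright.choose x
  have hy : Quotient.mk _ y = x := hright.choose_spec x
  have hchart : chartAt H x = (hmk.localInverseAt y).trans (chartAt H y) := rfl
  have hsymm : ∀ z, (extChartAt I x).symm z = Quotient.mk _ ((extChartAt I y).symm z) := fun z => by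
    simp [extChartAt, hchart]
  have hself : extChartAt I x x = extChartAt I y y := by
    have hinv : hmk.localInverseAt y x = y := hy ▸ hmk.localInverseAt_apply_self
    simp [extChartAt, hchart, hinv]
  refine contMDiffAt_iff.2 ⟨(continuous_coinduced_dom.2 hf.continuous).continuousAt, ?_⟩
  simp only [hself, Function.comp_def, hsymm]
  exact (contMDiffAt_iff.1 (hf y)).2

theorem smoothToUTS2_coordsEquiv : SmoothToUTS2 coordsEquiv :=
  contMDiff_of_comp_quotientMk smoothToUTS2_coords

end QuotientManifold

/-! ## The action of `SL(2, ℂ)` on Minkowski space and on flags -/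

section Action

theorem actHerm_add (A : SL2C) (S T : Herm) : actHerm A (S + T) = actHerm A S + actHerm A T :=
  Subtype.ext (by simp [actHerm, mul_add, add_mul])

theorem actHerm_smul (A : SL2C) (r : ℝ) (S : Herm) : actHerm A (r • S) = r • actHerm A S :=
  Subtype.ext (by simp [actHerm])

theorem actHerm_mul (A B : SL2C) (S : Herm) : actHerm (A * B) S = actHerm A (actHerm B S) :=
  Subtype.ext (by simp [actHerm, mul_assoc])

theorem actHerm_one (S : Herm) : actHerm 1 S = S :=
  Subtype.ext (by simp [actHerm])

theorem actMink_mul (A B : SL2C) (x : Mink) : actMink (A * B) x = actMink A (actMink B x) := by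
  simp only [actMink, actHerm_mul, LinearEquiv.symm_apply_apply]

theorem actMink_one (x : Mink) : actMink 1 x = x := by
  rw [actMink, actHerm_one, LinearEquiv.apply_symm_apply]

/-- The action of a matrix on Minkowski space as a continuous linear equivalence. -/
def actMinkEquiv (A : SL2C) : Mink ≃L[ℝ] Mink :=
  LinearEquiv.toContinuousLinearEquiv
    { toFun := actMink A
      invFun := actMink A⁻¹
      map_add' := fun x y => by simp only [actMink, map_add, actHerm_add]
      map_smul' := fun r x => by simp only [actMink, map_smul, actHerm_smul, RingHom.id_apply]
      left_inv := fun x => by rw [← actMink_mul, inv_mul_cancel, actMink_one]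
      right_inv := fun x => by rw [← actMink_mul, mul_inv_cancel, actMink_one] }

theorem coe_actMinkEquiv (A : SL2C) : ⇑(actMinkEquiv A) = actMink A := rfl

theorem minkInner_self_eq_det (x : Mink) :
    (minkInner x x : ℂ) = 4 * (hermEquiv.symm x : Herm).1.det := by
  rw [Matrix.det_fin_two]
  apply Complex.ext <;> simp [hermEquiv, herm, minkInner] <;> ring

theorem minkInner_actMink (A : SL2C) (x y : Mink) :
    minkInner (actMink A x) (actMink A y) = minkInner x y := by
  have polarization : ∀ x y : Mink,
      2 * minkInner x y = minkInner (x + y) (x + y) - minkInner x x - minkInner y y := fun x y => by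
    rw [minkInner_add_left, minkInner_add_right, minkInner_add_right, minkInner_comm y x]
    ring
  have hself : ∀ x, minkInner (actMink A x) (actMink A x) = minkInner x x := fun x => by
    apply Complex.ofReal_injective
    rw [minkInner_self_eq_det, minkInner_self_eq_det, actMink, LinearEquiv.symm_apply_apply,
      actHerm, Matrix.det_mul, Matrix.det_mul, Matrix.star_eq_conjTranspose,
      Matrix.det_conjTranspose, A.det_coe, star_one, one_mul, mul_one]
  have h := polarization (actMink A x) (actMink A y)
  rw [← coe_actMinkEquiv, ← map_add, coe_actMinkEquiv, hself, hself, hself, ← polarization] at h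
  exact mul_left_cancel₀ two_ne_zero h

theorem mulVec_ne_zero (A : SL2C) {κ : Fin 2 → ℂ} (hκ : κ ≠ 0) : A.1 *ᵥ κ ≠ 0 :=
  Spinor.ne_zero (A • (⟨κ, hκ⟩ : Spinor))

theorem actMink_nullVec (A : SL2C) (κ : Fin 2 → ℂ) :
    actMink A (nullVec κ) = nullVec (A.1 *ᵥ κ) := by
  rw [actMink, nullVec, nullVec, LinearEquiv.symm_apply_apply]
  congr 1
  apply Subtype.ext
  change A.1 * Matrix.vecMulVec κ (star κ) * star A.1 = Matrix.vecMulVec _ _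
  rw [Matrix.mul_vecMulVec, Matrix.vecMulVec_mul, Matrix.star_mulVec, Matrix.star_eq_conjTranspose]

theorem actMink_mem_hyperboloid {A : SL2C} {x : Mink} :
    actMink A x ∈ hyperboloid ↔ x ∈ hyperboloid := by
  have mapsTo : ∀ B : SL2C, Set.MapsTo (actMink B) hyperboloid hyperboloid := fun B =>
    mapsTo_hyperboloid_of_surjOn_lightCone (minkInner_actMink B) fun p hp => by
      obtain ⟨κ, hκ, rfl⟩ := exists_nullVec_eq hp
      refine ⟨nullVec (B⁻¹.1 *ᵥ κ), nullVec_mem_lightCone (mulVec_ne_zero B⁻¹ hκ), ?_⟩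
      rw [← actMink_nullVec, ← actMink_mul, mul_inv_cancel, actMink_one]
  refine ⟨fun h => ?_, fun h => mapsTo A h⟩
  simpa only [← actMink_mul, inv_mul_cancel, actMink_one] using mapsTo A⁻¹ h

/-- The symplectic form on `ℂ²`, which `SL(2, ℂ)` preserves. -/
def spinorBracket (κ ν : Fin 2 → ℂ) : ℂ := κ 0 * ν 1 - κ 1 * ν 0

theorem spinorBracket_mulVec (A : SL2C) (κ ν : Fin 2 → ℂ) :
    spinorBracket (A.1 *ᵥ κ) (A.1 *ᵥ ν) = spinorBracket κ ν := by
  have hA := A.2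
  rw [Matrix.det_fin_two] at hA
  simp only [spinorBracket, Matrix.mulVec, dotProduct, Fin.sum_univ_two]
  linear_combination (κ 0 * ν 1 - κ 1 * ν 0) * hA

theorem spinorBracket_spinorZ (κ : Fin 2 → ℂ) :
    spinorBracket κ (spinorZ κ) = -Complex.I * (nullVec κ 0 : ℂ) := by
  simp only [spinorBracket, spinorZ, nullVec_eq, Matrix.cons_val]
  apply Complex.ext <;> simp [pow_two] <;> ring

theorem spinorBracket_smul_eq (κ ν μ : Fin 2 → ℂ) :
    spinorBracket κ ν • μ = spinorBracket κ μ • ν + spinorBracket μ ν • κ := by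
  ext i
  fin_cases i <;> simp [spinorBracket] <;> ring

/-- Modulo `A κ`, vectors are determined by their bracket with `A κ`, and the brackets of `A κ` with
`Z(A κ)` and with `A (Z κ)` are both negative multiples of `i`. -/
theorem exists_spinorZ_mulVec (A : SL2C) {κ : Fin 2 → ℂ} (hκ : κ ≠ 0) :
    ∃ (r : ℝ) (μ : ℂ), 0 < r ∧
      spinorZ (A.1 *ᵥ κ) = (r : ℂ) • (A.1 *ᵥ spinorZ κ) + μ • (A.1 *ᵥ κ) := by
  have hT := nullVec_zero_pos hκ
  have hT' := nullVec_zero_pos (mulVec_ne_zero A hκ)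
  have h := spinorBracket_smul_eq (A.1 *ᵥ κ) (A.1 *ᵥ spinorZ κ) (spinorZ (A.1 *ᵥ κ))
  rw [spinorBracket_mulVec, spinorBracket_spinorZ, spinorBracket_spinorZ] at h
  have hc : -Complex.I * (nullVec κ 0 : ℂ) ≠ 0 :=
    mul_ne_zero (neg_ne_zero.2 Complex.I_ne_zero) (Complex.ofReal_ne_zero.2 hT.ne')
  have hr : (-Complex.I * (nullVec κ 0 : ℂ))⁻¹ * (-Complex.I * (nullVec (A.1 *ᵥ κ) 0 : ℂ)) =
      ((nullVec (A.1 *ᵥ κ) 0 / nullVec κ 0 : ℝ) : ℂ) := by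
    rw [Complex.ofReal_div, mul_inv, mul_mul_mul_comm,
      inv_mul_cancel₀ (neg_ne_zero.2 Complex.I_ne_zero), one_mul, mul_comm, div_eq_mul_inv]
  have h' := congrArg ((-Complex.I * (nullVec κ 0 : ℂ))⁻¹ • ·) h
  simp only [inv_smul_smul₀ hc, smul_add, smul_smul, hr] at h'
  exact ⟨_, _, div_pos hT' hT, h'⟩

theorem actHerm_spinorSqDeriv (A : SL2C) (κ ν : Fin 2 → ℂ) :
    actHerm A (spinorSqDeriv κ ν) = spinorSqDeriv (A.1 *ᵥ κ) (A.1 *ᵥ ν) := by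
  ext i j
  simp only [actHerm, Matrix.star_eq_conjTranspose, spinorSqDeriv_apply]
  simp [Matrix.mul_apply, Matrix.mulVec, dotProduct, Fin.sum_univ_two, spinorSqDeriv_apply]
  ring

theorem spinorSqDeriv_smul_add_smul (κ ν : Fin 2 → ℂ) (r : ℝ) (μ : ℂ) :
    spinorSqDeriv κ ((r : ℂ) • ν + μ • κ) = r • spinorSqDeriv κ ν + (2 * μ.re) • spinorSq κ := by
  have hμ : ((2 * μ.re : ℝ) : ℂ) = μ + star μ := (Complex.add_conj μ).symm
  ext i j
  simp only [AddSubgroup.coe_add, selfAdjoint.val_smul, Matrix.add_apply, Matrix.smul_apply,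
    Complex.real_smul, hμ, spinorSqDeriv_apply, spinorSq_apply, Pi.add_apply, Pi.smul_apply,
    smul_eq_mul, star_add, star_mul', Complex.star_def, Complex.conj_ofReal]
  ring

theorem exists_flagVec_mulVec (A : SL2C) {κ : Fin 2 → ℂ} (hκ : κ ≠ 0) :
    ∃ r s : ℝ, 0 < r ∧
      flagVec (A.1 *ᵥ κ) = r • actMink A (flagVec κ) + s • nullVec (A.1 *ᵥ κ) := by
  obtain ⟨r, μ, hr, h⟩ := exists_spinorZ_mulVec A hκ
  refine ⟨r, 2 * μ.re, hr, ?_⟩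
  rw [actMink, flagVec, flagVec, nullVec, LinearEquiv.symm_apply_apply, actHerm_spinorSqDeriv, h,
    spinorSqDeriv_smul_add_smul, map_add, map_smul, map_smul]

/-- The flag `G(F(κ))`. -/
def spinorFlag (κ : Spinor) : NullFlag lightCone := mapG (mapF κ)

theorem spinorFlag_point (κ : Spinor) : (spinorFlag κ).point = nullVec κ := rfl

theorem spinorFlag_pos (κ : Spinor) : (spinorFlag κ).pos = halfPlane (nullVec κ) (flagVec κ) :=
  image_halfPlane hermEquiv.toLinearMap _ _

theorem spinorFlag_smul_point (A : SL2C) (κ : Spinor) :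
    (spinorFlag (A • κ)).point = actMinkEquiv A (spinorFlag κ).point := by
  rw [spinorFlag_point, spinorFlag_point, coe_actMinkEquiv, actMink_nullVec, Spinor.coe_smul]

theorem spinorFlag_smul_pos (A : SL2C) (κ : Spinor) :
    (spinorFlag (A • κ)).pos = actMinkEquiv A '' (spinorFlag κ).pos := by
  obtain ⟨r, s, hr, h⟩ := exists_flagVec_mulVec A κ.ne_zero
  have himage : actMinkEquiv A '' halfPlane (nullVec κ) (flagVec κ) =
      halfPlane (actMink A (nullVec κ)) (actMink A (flagVec κ)) :=
    image_halfPlane (actMinkEquiv A).toLinearEquiv.toLinearMap _ _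
  rw [spinorFlag_pos, spinorFlag_pos, himage, Spinor.coe_smul, h, halfPlane_smul_add_smul hr,
    actMink_nullVec]

theorem mapH_spinorFlag_smul (A : SL2C) (κ : Spinor) :
    mapH (spinorFlag (A • κ)) = (mapH (spinorFlag κ)).map (actMink A) :=
  (mapH_map (actMinkEquiv A) (minkInner_actMink A) (fun _ => actMink_mem_hyperboloid)
    (spinorFlag_smul_point A κ) (spinorFlag_smul_pos A κ)).symm

end Action

/-! ## The upper half space model -/

section UpperHalfSpace

theorem isOpen_upperHalf : IsOpen upperHalf :=
  isOpen_lt continuous_const (continuous_apply 2)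

theorem sub_pos_of_mem_hyperboloid {x : Mink} (hx : x ∈ hyperboloid) : 0 < x 0 - x 3 := by
  obtain ⟨h1, h2⟩ := hx
  rw [minkInner] at h1
  nlinarith [sq_nonneg (x 1), sq_nonneg (x 2)]

/-- The isometry from the hyperboloid to the upper half space model, in closed form. -/
def toUpperHalf (x : Mink) : R3 :=
  ![x 1 / (x 0 - x 3), x 2 / (x 0 - x 3), 1 / (x 0 - x 3)]

/-- The inverse of `toUpperHalf`. -/
def ofUpperHalf (y : R3) : Mink :=
  ![(y 0 ^ 2 + y 1 ^ 2 + y 2 ^ 2 + 1) / (2 * y 2), y 0 / y 2, y 1 / y 2,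
    (y 0 ^ 2 + y 1 ^ 2 + y 2 ^ 2 - 1) / (2 * y 2)]

theorem toUpperHalf_mem {x : Mink} (hx : x ∈ hyperboloid) : toUpperHalf x ∈ upperHalf :=
  one_div_pos.2 (sub_pos_of_mem_hyperboloid hx)

theorem ofUpperHalf_mem {y : R3} (hy : y ∈ upperHalf) : ofUpperHalf y ∈ hyperboloid := by
  have h : 0 < y 2 := hy
  constructor
  · simp only [minkInner, ofUpperHalf, Matrix.cons_val]
    field_simp
    ring
  · simp only [ofUpperHalf, Matrix.cons_val]
    positivity

theorem toUpperHalf_ofUpperHalf {y : R3} (hy : y ∈ upperHalf) :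
    toUpperHalf (ofUpperHalf y) = y := by
  have h : y 2 ≠ 0 := ne_of_gt hy
  have hD : ofUpperHalf y 0 - ofUpperHalf y 3 = 1 / y 2 := by
    simp only [ofUpperHalf, Matrix.cons_val]
    field_simp
    ring
  ext i
  rw [toUpperHalf, hD]
  fin_cases i <;> simp [ofUpperHalf, h]

theorem ofUpperHalf_toUpperHalf {x : Mink} (hx : x ∈ hyperboloid) :
    ofUpperHalf (toUpperHalf x) = x := by
  have h := (sub_pos_of_mem_hyperboloid hx).ne'
  have hx := hx.1
  rw [minkInner] at hx
  ext i
  fin_cases i <;> simp [toUpperHalf, ofUpperHalf] <;> field_simp <;> linear_combination -hx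

theorem one_sub_iMap_dotProduct_self {x : Mink} (hx : x ∈ hyperboloid) :
    1 - iMap x ⬝ᵥ iMap x = 2 / (1 + x 0) := by
  obtain ⟨hx, h0⟩ := hx
  rw [minkInner] at hx
  simp only [iMap, dotProduct, Fin.sum_univ_three, Matrix.cons_val]
  field_simp
  linear_combination hx

theorem iMap_mem_disc {x : Mink} (hx : x ∈ hyperboloid) : iMap x ∈ disc := by
  have h : 0 < 2 / (1 + x 0) := div_pos two_pos (add_pos one_pos hx.2)
  rwa [← one_sub_iMap_dotProduct_self hx, sub_pos] at h

theorem jMap_iMap {x : Mink} (hx : x ∈ hyperboloid) : jMap (iMap x) = toUpperHalf x := by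
  have h1 : 1 + x 0 ≠ 0 := (add_pos one_pos hx.2).ne'
  have h2 := (sub_pos_of_mem_hyperboloid hx).ne'
  have hD : iMap x 0 ^ 2 + iMap x 1 ^ 2 + (1 - iMap x 2) ^ 2 = 2 * (x 0 - x 3) / (1 + x 0) := by
    have h := hx.1
    rw [minkInner] at h
    simp only [iMap, Matrix.cons_val]
    field_simp
    linear_combination -h
  ext i
  rw [jMap, one_sub_iMap_dotProduct_self hx, hD]
  fin_cases i <;> simp [iMap, toUpperHalf] <;> field_simp

theorem iInv_jInv {y : R3} (hy : y ∈ upperHalf) : iInv (jInv y) = ofUpperHalf y := by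
  have h : 0 < y 2 := hy
  have hS : jInv y ⬝ᵥ jInv y = 1 - 4 * y 2 / (y 0 ^ 2 + y 1 ^ 2 + (y 2 + 1) ^ 2) := by
    simp only [jInv, dotProduct, Fin.sum_univ_three, Matrix.cons_val]
    field_simp
    ring
  ext i
  rw [iInv, hS]
  fin_cases i <;> simp [jInv, dotProduct, Fin.sum_univ_three, ofUpperHalf] <;> field_simp <;> ring

theorem differentiableAt_toUpperHalf {x : Mink} (hx : x ∈ hyperboloid) :
    DifferentiableAt ℝ toUpperHalf x := by
  have h := (sub_pos_of_mem_hyperboloid hx).ne'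
  refine differentiableAt_pi.2 fun i => ?_
  fin_cases i <;> simp only [toUpperHalf, Fin.zero_eta, Fin.mk_one, Fin.reduceFinMk,
    Matrix.cons_val] <;> fun_prop (disch := assumption)

theorem differentiableAt_ofUpperHalf {y : R3} (hy : y ∈ upperHalf) :
    DifferentiableAt ℝ ofUpperHalf y := by
  have h : y 2 ≠ 0 := ne_of_gt hy
  have h' : 2 * y 2 ≠ 0 := mul_ne_zero two_ne_zero h
  refine differentiableAt_pi.2 fun i => ?_
  fin_cases i <;> simp only [ofUpperHalf, Fin.zero_eta, Fin.mk_one, Fin.reduceFinMk,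
    Matrix.cons_val] <;> fun_prop (disch := assumption)

theorem differentiableAt_iMap {x : Mink} (hx : x ∈ hyperboloid) : DifferentiableAt ℝ iMap x := by
  have h : 1 + x 0 ≠ 0 := (add_pos one_pos hx.2).ne'
  refine differentiableAt_pi.2 fun i => ?_
  fin_cases i <;> simp only [iMap, Fin.zero_eta, Fin.mk_one, Fin.reduceFinMk,
    Matrix.cons_val] <;> fun_prop (disch := assumption)

theorem differentiableAt_jMap {y : R3} (hy : y ∈ disc) : DifferentiableAt ℝ jMap y := by
  have h : y 0 ^ 2 + y 1 ^ 2 + (1 - y 2) ^ 2 ≠ 0 := by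
    have hy : y ⬝ᵥ y < 1 := hy
    simp only [dotProduct, Fin.sum_univ_three] at hy
    have : y 2 < 1 := by nlinarith [sq_nonneg (y 0), sq_nonneg (y 1)]
    have : 0 < 1 - y 2 := sub_pos.2 this
    positivity
  refine differentiableAt_pi.2 fun i => ?_
  fin_cases i <;> simp only [jMap, dotProduct, Fin.sum_univ_three, Fin.zero_eta, Fin.mk_one,
    Fin.reduceFinMk, Matrix.cons_val] <;> fun_prop (disch := assumption)

theorem actUpper_eq (A : SL2C) {y : R3} (hy : y ∈ upperHalf) :
    actUpper A y = toUpperHalf (actMink A (ofUpperHalf y)) := by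
  rw [actUpper, actDisc, iInv_jInv hy, jMap_iMap (actMink_mem_hyperboloid.2 (ofUpperHalf_mem hy))]

theorem actUpper_toUpperHalf (A : SL2C) {x : Mink} (hx : x ∈ hyperboloid) :
    actUpper A (toUpperHalf x) = toUpperHalf (actMink A x) := by
  rw [actUpper_eq A (toUpperHalf_mem hx), ofUpperHalf_toUpperHalf hx]

theorem actUpper_mem (A : SL2C) {y : R3} (hy : y ∈ upperHalf) : actUpper A y ∈ upperHalf := by
  rw [actUpper_eq A hy]
  exact toUpperHalf_mem (actMink_mem_hyperboloid.2 (ofUpperHalf_mem hy))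

theorem actUpper_mul (A B : SL2C) {y : R3} (hy : y ∈ upperHalf) :
    actUpper (A * B) y = actUpper A (actUpper B y) := by
  rw [actUpper_eq B hy,
    actUpper_toUpperHalf A (actMink_mem_hyperboloid.2 (ofUpperHalf_mem hy)), ← actMink_mul,
    actUpper_eq _ hy]

theorem actUpper_one {y : R3} (hy : y ∈ upperHalf) : actUpper 1 y = y := by
  rw [actUpper_eq 1 hy, actMink_one, toUpperHalf_ofUpperHalf hy]

theorem leftInvOn_actUpper (A : SL2C) : Set.LeftInvOn (actUpper A⁻¹) (actUpper A) upperHalf :=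
  fun y hy => by rw [← actUpper_mul _ _ hy, inv_mul_cancel, actUpper_one hy]

theorem differentiableAt_actUpper (A : SL2C) {y : R3} (hy : y ∈ upperHalf) :
    DifferentiableAt ℝ (actUpper A) y := by
  have h : DifferentiableAt ℝ (toUpperHalf ∘ actMinkEquiv A ∘ ofUpperHalf) y :=
    (differentiableAt_toUpperHalf (actMink_mem_hyperboloid.2 (ofUpperHalf_mem hy))).comp y
      ((actMinkEquiv A).differentiableAt.comp y (differentiableAt_ofUpperHalf hy))
  refine h.congr_of_eventuallyEq ?_
  filter_upwards [isOpen_upperHalf.mem_nhds hy] with z hz using actUpper_eq A hz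

theorem mapJ_mapI_mapH (P : NullFlag lightCone) :
    mapJ (mapI (mapH P)) = (mapH P).map toUpperHalf := by
  have hi : ∀ x ∈ (mapH P).carrier, DifferentiableAt ℝ iMap x :=
    fun x hx => differentiableAt_iMap hx.1
  have hj : ∀ x ∈ (mapH P).carrier, DifferentiableAt ℝ jMap (iMap x) :=
    fun x hx => differentiableAt_jMap (iMap_mem_disc hx.1)
  rw [mapJ, mapI, OverlyDecorated.map_map _ hi hj]
  exact OverlyDecorated.map_congr (isOrientedLineField_mapH P).isTangent
    (fun x hx => (hj x hx).comp x (hi x hx)) (fun x hx => differentiableAt_toUpperHalf hx.1)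
    fun x hx => jMap_iMap hx.1

/-- The horosphere `J(I(H(G(F(κ)))))` with its oriented line field. -/
def spinorHorosphere (κ : Spinor) : OverlyDecorated R3 :=
  mapJ (mapI (mapH (spinorFlag κ)))

theorem isOrientedLineField_spinorHorosphere (κ : Spinor) :
    (spinorHorosphere κ).IsOrientedLineField := by
  rw [spinorHorosphere, mapJ_mapI_mapH]
  exact (isOrientedLineField_mapH _).map (fun x hx => differentiableAt_toUpperHalf hx.1)
    (fun x hx => differentiableAt_ofUpperHalf (toUpperHalf_mem hx.1))
    fun x hx => ofUpperHalf_toUpperHalf hx.1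

theorem spinorHorosphere_smul (A : SL2C) (κ : Spinor) :
    spinorHorosphere (A • κ) = (spinorHorosphere κ).map (actUpper A) := by
  have hT : ∀ x ∈ (mapH (spinorFlag κ)).carrier, DifferentiableAt ℝ toUpperHalf x :=
    fun x hx => differentiableAt_toUpperHalf hx.1
  have hA : ∀ x ∈ (mapH (spinorFlag κ)).carrier,
      DifferentiableAt ℝ (actUpper A) (toUpperHalf x) :=
    fun x hx => differentiableAt_actUpper A (toUpperHalf_mem hx.1)
  have hM : ∀ x ∈ (mapH (spinorFlag κ)).carrier, DifferentiableAt ℝ (actMink A) x :=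
    fun x _ => (actMinkEquiv A).differentiableAt
  have hTM : ∀ x ∈ (mapH (spinorFlag κ)).carrier, DifferentiableAt ℝ toUpperHalf (actMink A x) :=
    fun x hx => differentiableAt_toUpperHalf (actMink_mem_hyperboloid.2 hx.1)
  rw [spinorHorosphere, spinorHorosphere, mapJ_mapI_mapH, mapJ_mapI_mapH, mapH_spinorFlag_smul,
    OverlyDecorated.map_map _ hM hTM, OverlyDecorated.map_map _ hT hA]
  exact OverlyDecorated.map_congr (isOrientedLineField_mapH _).isTangent
    (fun x hx => (hTM x hx).comp x (hM x hx)) (fun x hx => (hA x hx).comp x (hT x hx))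
    fun x hx => (actUpper_toUpperHalf A hx.1).symm

theorem mem_spinorHorosphere_carrier_iff_ofUpperHalf {κ : Spinor} {y : R3} :
    y ∈ (spinorHorosphere κ).carrier ↔
      y ∈ upperHalf ∧ minkInner (ofUpperHalf y) (nullVec κ) = 1 := by
  rw [spinorHorosphere, mapJ_mapI_mapH]
  constructor
  · rintro ⟨x, ⟨hx, hxp⟩, rfl⟩
    exact ⟨toUpperHalf_mem hx, by rwa [ofUpperHalf_toUpperHalf hx]⟩
  · rintro ⟨hy, h⟩
    exact ⟨ofUpperHalf y, ⟨ofUpperHalf_mem hy, h⟩, toUpperHalf_ofUpperHalf hy⟩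

theorem mem_spinorHorosphere_carrier {κ : Spinor} {y : R3} :
    y ∈ (spinorHorosphere κ).carrier ↔ y ∈ upperHalf ∧
      Complex.normSq (κ.1 1 * ⟨y 0, y 1⟩ - κ.1 0) + Complex.normSq (κ.1 1) * y 2 ^ 2 = y 2 := by
  rw [mem_spinorHorosphere_carrier_iff_ofUpperHalf]
  refine and_congr_right fun hy => ?_
  have h : y 2 ≠ 0 := ne_of_gt hy
  have key : Complex.normSq (κ.1 1 * ⟨y 0, y 1⟩ - κ.1 0) + Complex.normSq (κ.1 1) * y 2 ^ 2 =
      minkInner (ofUpperHalf y) (nullVec κ) * y 2 := by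
    simp only [minkInner, ofUpperHalf, nullVec_eq, Complex.normSq_apply, Complex.sub_re,
      Complex.sub_im, Complex.mul_re, Complex.mul_im, Matrix.cons_val]
    field_simp
    ring
  rw [key, mul_eq_right₀ h]

end UpperHalfSpace

/-! ## Decorated horospheres and the action of `SL(2, ℂ)` on them -/

section Decorated

theorem IsHorosphere.subset_upperHalf {s : Set R3} (hs : IsHorosphere s) : s ⊆ upperHalf := by
  rcases hs with ⟨c, hc, rfl⟩ | ⟨a, b, r, -, rfl⟩
  · exact fun y hy => hc.trans_eq (Eq.symm hy)
  · exact fun y hy => hy.1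

theorem spinorHorosphere_carrier_of_eq_zero {κ : Spinor} (h : κ.1 1 = 0) :
    (spinorHorosphere κ).carrier = {y | y 2 = Complex.normSq (κ.1 0)} := by
  have h0 : κ.1 0 ≠ 0 := fun h0 => κ.ne_zero (by ext i; fin_cases i <;> assumption)
  ext y
  rw [mem_spinorHorosphere_carrier, h, zero_mul, zero_sub, Complex.normSq_neg, map_zero, zero_mul,
    add_zero]
  exact ⟨fun hy => hy.2.symm, fun hy => ⟨(Complex.normSq_pos.2 h0).trans_eq (Eq.symm hy),
    Eq.symm hy⟩⟩

theorem spinorHorosphere_carrier_of_ne_zero {κ : Spinor} (h : κ.1 1 ≠ 0) :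
    (spinorHorosphere κ).carrier = {y | y ∈ upperHalf ∧ (y 0 - (κ.1 0 / κ.1 1).re) ^ 2 +
      (y 1 - (κ.1 0 / κ.1 1).im) ^ 2 + (y 2 - 1 / (2 * Complex.normSq (κ.1 1))) ^ 2 =
      (1 / (2 * Complex.normSq (κ.1 1))) ^ 2} := by
  have hN : Complex.normSq (κ.1 1) ≠ 0 := (Complex.normSq_pos.2 h).ne'
  ext y
  rw [mem_spinorHorosphere_carrier]
  refine and_congr_right fun _ => ?_
  have hfactor : κ.1 1 * ⟨y 0, y 1⟩ - κ.1 0 = κ.1 1 * (⟨y 0, y 1⟩ - κ.1 0 / κ.1 1) := by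
    rw [mul_sub, mul_div_cancel₀ _ h]
  rw [hfactor, Complex.normSq_mul, Complex.normSq_apply (_ - _), Complex.sub_re, Complex.sub_im]
  generalize Complex.normSq (κ.1 1) = N at hN
  constructor
  · intro hy
    field_simp
    linear_combination 4 * N * hy
  · intro hy
    field_simp at hy
    refine mul_left_cancel₀ (mul_ne_zero four_ne_zero hN) ?_
    linear_combination hy

theorem isHorosphere_iff_exists_spinorHorosphere {s : Set R3} :
    IsHorosphere s ↔ ∃ κ, s = (spinorHorosphere κ).carrier := by
  constructor
  · rintro (⟨c, hc, rfl⟩ | ⟨a, b, r, hr, rfl⟩)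
    · have hne : (√c : ℂ) ≠ 0 := Complex.ofReal_ne_zero.2 (Real.sqrt_pos.2 hc).ne'
      refine ⟨⟨![√c, 0], fun h => hne (congrFun h 0)⟩, ?_⟩
      rw [spinorHorosphere_carrier_of_eq_zero rfl]
      simp only [Matrix.cons_val_zero, Complex.normSq_ofReal, Real.mul_self_sqrt hc.le]
    · have hn : 0 < 1 / (2 * r) := by positivity
      have hne : (√(1 / (2 * r)) : ℂ) ≠ 0 := Complex.ofReal_ne_zero.2 (Real.sqrt_pos.2 hn).ne'
      refine ⟨⟨![√(1 / (2 * r)) * ⟨a, b⟩, √(1 / (2 * r))], fun h => hne (congrFun h 1)⟩, ?_⟩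
      rw [spinorHorosphere_carrier_of_ne_zero hne]
      have hr' : 1 / (2 * (1 / (2 * r))) = r := by field_simp
      simp only [Matrix.cons_val_zero, Matrix.cons_val_one, mul_div_cancel_left₀ _ hne,
        Complex.normSq_ofReal, Real.mul_self_sqrt hn.le, hr']
  · rintro ⟨κ, rfl⟩
    rcases eq_or_ne (κ.1 1) 0 with h | h
    · have h0 : κ.1 0 ≠ 0 := fun h0 => κ.ne_zero (by ext i; fin_cases i <;> assumption)
      exact Or.inl ⟨_, Complex.normSq_pos.2 h0, spinorHorosphere_carrier_of_eq_zero h⟩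
    · have hN := Complex.normSq_pos.2 h
      exact Or.inr ⟨_, _, _, by positivity, spinorHorosphere_carrier_of_ne_zero h⟩

theorem image_actUpper_spinorHorosphere (A : SL2C) (κ : Spinor) :
    actUpper A '' (spinorHorosphere κ).carrier = (spinorHorosphere (A • κ)).carrier := by
  rw [spinorHorosphere_smul]
  rfl

theorem IsHorosphere.image_actUpper (A : SL2C) {s : Set R3} (hs : IsHorosphere s) :
    IsHorosphere (actUpper A '' s) := by
  obtain ⟨κ, rfl⟩ := isHorosphere_iff_exists_spinorHorosphere.1 hs
  exact isHorosphere_iff_exists_spinorHorosphere.2 ⟨_, image_actUpper_spinorHorosphere A κ⟩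

theorem map_actUpper_map_actUpper {S : OverlyDecorated R3} (hU : S.carrier ⊆ upperHalf)
    (hS : S.IsOrientedLineField) (A B : SL2C) :
    (S.map (actUpper B)).map (actUpper A) = S.map (actUpper (A * B)) := by
  have hB : ∀ q ∈ S.carrier, DifferentiableAt ℝ (actUpper B) q :=
    fun q hq => differentiableAt_actUpper B (hU hq)
  have hA : ∀ q ∈ S.carrier, DifferentiableAt ℝ (actUpper A) (actUpper B q) :=
    fun q hq => differentiableAt_actUpper A (actUpper_mem B (hU hq))
  rw [OverlyDecorated.map_map _ hB hA]
  exact OverlyDecorated.map_congr hS.isTangent (fun q hq => (hA q hq).comp q (hB q hq))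
    (fun _ hq => differentiableAt_actUpper _ (hU hq))
    fun _ hq => (actUpper_mul A B (hU hq)).symm

theorem map_actUpper_one {S : OverlyDecorated R3} (hU : S.carrier ⊆ upperHalf)
    (hS : S.IsOrientedLineField) : S.map (actUpper 1) = S :=
  hS.map_eq_self (fun _ hq => differentiableAt_actUpper 1 (hU hq)) fun _ hq => actUpper_one (hU hq)

theorem isOrientedLineField_map_actUpper {S : OverlyDecorated R3} (hU : S.carrier ⊆ upperHalf)
    (hS : S.IsOrientedLineField) (A : SL2C) : (S.map (actUpper A)).IsOrientedLineField :=
  hS.map (fun _ hq => differentiableAt_actUpper A (hU hq))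
    (fun _ hq => differentiableAt_actUpper A⁻¹ (actUpper_mem A (hU hq)))
    ((leftInvOn_actUpper A).mono hU)

/-- A parabolic `B` preserves the image under `A` exactly when the parabolic `A⁻¹ B A` preserves the
original horosphere. -/
theorem isParallel_map_actUpper {S : OverlyDecorated R3} (hU : S.carrier ⊆ upperHalf)
    (hS : S.IsOrientedLineField) (hP : S.IsParallel) (A : SL2C) :
    (S.map (actUpper A)).IsParallel := by
  intro B hB hBS
  have htrace : (A⁻¹ * (B * A)).1.trace = B.1.trace := by
    rw [Matrix.SpecialLinearGroup.coe_mul, Matrix.trace_mul_comm,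
      ← Matrix.SpecialLinearGroup.coe_mul, mul_inv_cancel_right]
  have himage : actUpper (A⁻¹ * (B * A)) '' S.carrier = S.carrier := by
    change (S.map (actUpper (A⁻¹ * (B * A)))).carrier = S.carrier
    rw [← map_actUpper_map_actUpper hU hS, ← map_actUpper_map_actUpper hU hS]
    change actUpper A⁻¹ '' (actUpper B '' (S.map (actUpper A)).carrier) = S.carrier
    rw [hBS]
    exact ((leftInvOn_actUpper A).mono hU).image_image
  have h := hP (A⁻¹ * (B * A)) (by rwa [htrace]) himage
  calc (S.map (actUpper A)).map (actUpper B) = S.map (actUpper (A * (A⁻¹ * (B * A)))) := by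
        rw [map_actUpper_map_actUpper hU hS, mul_inv_cancel_left]
    _ = S.map (actUpper A) := by rw [← map_actUpper_map_actUpper hU hS, h]

instance : MulAction SL2C DecoratedHorosphere where
  smul A D := ⟨D.1.map (actUpper A), D.2.1.image_actUpper A,
    isOrientedLineField_map_actUpper D.2.1.subset_upperHalf D.2.2.1 A,
    isParallel_map_actUpper D.2.1.subset_upperHalf D.2.2.1 D.2.2.2 A⟩
  one_smul D := Subtype.ext (map_actUpper_one D.2.1.subset_upperHalf D.2.2.1)
  mul_smul A B D :=
    Subtype.ext (map_actUpper_map_actUpper D.2.1.subset_upperHalf D.2.2.1 A B).symm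

theorem DecoratedHorosphere.coe_smul (A : SL2C) (D : DecoratedHorosphere) :
    (A • D).1 = D.1.map (actUpper A) := rfl

end Decorated

/-! ## Horospheres centred at infinity -/

section Plane

/-- The plane `z = 1` with the constant line field directed by `w`, where `ℂ` is identified with the
horizontal directions. -/
def horizontalHorosphere (w : ℂ) : OverlyDecorated R3 where
  carrier := {y | y 2 = 1}
  dir y := {v | y 2 = 1 ∧ v ∈ openRay ![w.re, w.im, 0]}

theorem horizontalHorosphere_ofReal_mul {c : ℝ} (hc : 0 < c) (w : ℂ) :
    horizontalHorosphere (c * w) = horizontalHorosphere w := by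
  have h : ![((c : ℂ) * w).re, ((c : ℂ) * w).im, 0] = c • ![w.re, w.im, 0] := by
    ext i
    fin_cases i <;> simp
  simp only [horizontalHorosphere, h, openRay_smul hc]

theorem injOn_horizontalHorosphere : Set.InjOn horizontalHorosphere {w | ‖w‖ = 1} := by
  intro w (hw : ‖w‖ = 1) w' (hw' : ‖w'‖ = 1) h
  have hmem : ![w.re, w.im, 0] ∈ (horizontalHorosphere w').dir ![0, 0, 1] :=
    h ▸ ⟨rfl, self_mem_openRay _⟩
  obtain ⟨-, c, hc, hv⟩ := hmem
  have hcw : w = c * w' := by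
    apply Complex.ext
    · simpa using congrFun hv 0
    · simpa using congrFun hv 1
  have hc1 : c = 1 := by
    rwa [hcw, norm_mul, hw', mul_one, Complex.norm_real, Real.norm_of_nonneg hc.le] at hw
  rw [hcw, hc1, Complex.ofReal_one, one_mul]

theorem fderiv_toUpperHalf {x w : Mink} (hx : x ∈ hyperboloid) (hw : w 0 = w 3) :
    fderiv ℝ toUpperHalf x w = (x 0 - x 3)⁻¹ • ![w 1, w 2, 0] := by
  refine fderiv_apply_eq_of_line (differentiableAt_toUpperHalf hx) (Filter.Eventually.of_forall ?_)
  intro s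
  ext i
  fin_cases i <;> simp [toUpperHalf, hw] <;> ring

theorem spinorHorosphere_eq_horizontalHorosphere {κ : Spinor} (h1 : κ.1 1 = 0)
    (h0 : Complex.normSq (κ.1 0) = 1) :
    spinorHorosphere κ = horizontalHorosphere (Complex.I * κ.1 0 ^ 2) := by
  have hcarrier := spinorHorosphere_carrier_of_eq_zero h1
  rw [h0] at hcarrier
  refine OverlyDecorated.ext hcarrier (funext fun y => ?_)
  by_cases hy : y 2 = 1
  · have hinj : Set.InjOn toUpperHalf (mapH (spinorFlag κ)).carrier :=
      Set.LeftInvOn.injOn (f₁' := ofUpperHalf) fun x hx => ofUpperHalf_toUpperHalf hx.1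
    have hyS : y ∈ (spinorHorosphere κ).carrier := by rwa [hcarrier]
    rw [spinorHorosphere, mapJ_mapI_mapH] at hyS ⊢
    obtain ⟨x, hx, rfl⟩ := hyS
    have hx1 : x 0 - x 3 = 1 := inv_eq_one.1 ((one_div _).symm.trans hy)
    set w := flagVec κ - minkInner (flagVec κ) x • nullVec κ with hw
    have hw03 : w 0 = w 3 := by simp [hw, flagVec_eq, nullVec_eq, h1]
    have hdir : ![w 1, w 2, 0] =
        (2 : ℝ) • ![(Complex.I * κ.1 0 ^ 2).re, (Complex.I * κ.1 0 ^ 2).im, 0] := by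
      ext i
      fin_cases i <;> simp [hw, flagVec_eq, nullVec_eq, h1, pow_two]
      ring
    rw [OverlyDecorated.map_dir_of_injOn hinj hx,
      mapH_dir (minkInner_flagVec_nullVec κ) (spinorFlag_pos κ) hx]
    refine (image_openRay (fderiv ℝ toUpperHalf x).toLinearMap w).trans ?_
    rw [ContinuousLinearMap.coe_coe, fderiv_toUpperHalf hx.1 hw03, hx1, inv_one, one_smul, hdir,
      openRay_smul two_pos]
    exact Set.ext fun v => (and_iff_right hy).symm
  · rw [(isOrientedLineField_spinorHorosphere κ).2 y (by rwa [hcarrier])]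
    exact (Set.eq_empty_iff_forall_notMem.2 fun v hv => hy hv.1).symm

theorem spinorHorosphere_carrier_eq_plane_iff {κ : Spinor} :
    (spinorHorosphere κ).carrier = {y | y 2 = 1} ↔
      κ.1 1 = 0 ∧ Complex.normSq (κ.1 0) = 1 := by
  constructor
  · intro h
    have h1 : κ.1 1 = 0 := by
      by_contra h1
      set z := (κ.1 0 + 2) / κ.1 1 with hz
      have hmem : ![z.re, z.im, 1] ∈ (spinorHorosphere κ).carrier := by
        rw [h]
        rfl
      have heq : κ.1 1 * ⟨z.re, z.im⟩ - κ.1 0 = 2 := by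
        rw [Complex.eta, hz, mul_div_cancel₀ _ h1, add_sub_cancel_left]
      have hval := (mem_spinorHorosphere_carrier.1 hmem).2
      simp only [Matrix.cons_val, heq] at hval
      norm_num [Complex.normSq_apply (2 : ℂ)] at hval
      linarith [Complex.normSq_nonneg (κ.1 1)]
    refine ⟨h1, ?_⟩
    rw [spinorHorosphere_carrier_of_eq_zero h1] at h
    have hmem : (![0, 0, 1] : R3) ∈ {y : R3 | y 2 = Complex.normSq (κ.1 0)} := by
      rw [h]
      rfl
    exact hmem.symm
  · rintro ⟨h1, h0⟩
    rw [spinorHorosphere_carrier_of_eq_zero h1, h0]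

/-- The spinor `(1, 0)`, whose horosphere is the plane `z = 1`. -/
def baseSpinor : Spinor := ⟨![1, 0], fun h => one_ne_zero (congrFun h 0)⟩

theorem coe_baseSpinor : (baseSpinor : Fin 2 → ℂ) = ![1, 0] := rfl

theorem spinorHorosphere_baseSpinor :
    spinorHorosphere baseSpinor = horizontalHorosphere Complex.I := by
  rw [spinorHorosphere_eq_horizontalHorosphere rfl Complex.normSq_one, coe_baseSpinor,
    Matrix.cons_val_zero, one_pow, mul_one]

theorem exists_smul_baseSpinor (κ : Spinor) : ∃ A : SL2C, A • baseSpinor = κ := by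
  by_cases h : κ.1 0 = 0
  · have h1 : κ.1 1 ≠ 0 := fun h1 => κ.ne_zero (by ext i; fin_cases i <;> assumption)
    refine ⟨⟨!![0, -(κ.1 1)⁻¹; κ.1 1, 0], by simp [Matrix.det_fin_two, h1]⟩, Subtype.ext ?_⟩
    refine (Spinor.coe_smul _ _).trans ?_
    rw [coe_baseSpinor]
    ext i
    fin_cases i <;> simp [h]
  · refine ⟨⟨!![κ.1 0, 0; κ.1 1, (κ.1 0)⁻¹], by simp [Matrix.det_fin_two, h]⟩, Subtype.ext ?_⟩
    refine (Spinor.coe_smul _ _).trans ?_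
    rw [coe_baseSpinor]
    ext i
    fin_cases i <;> simp

theorem modSign_eq_modSign_baseSpinor {κ : Spinor} :
    modSign κ = modSign baseSpinor ↔ κ.1 1 = 0 ∧ κ.1 0 ^ 2 = 1 := by
  rw [modSign_eq_iff, coe_baseSpinor, sq_eq_one_iff]
  simp only [funext_iff, Fin.forall_fin_two, Matrix.cons_val_zero, Matrix.cons_val_one,
    Pi.neg_apply, eq_comm (a := (0 : ℂ)), eq_comm (a := (1 : ℂ)), neg_eq_iff_eq_neg, neg_zero]
  tauto

theorem spinorHorosphere_eq_spinorHorosphere_baseSpinor {κ : Spinor} :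
    spinorHorosphere κ = spinorHorosphere baseSpinor ↔ modSign κ = modSign baseSpinor := by
  rw [modSign_eq_modSign_baseSpinor, spinorHorosphere_baseSpinor]
  constructor
  · intro h
    obtain ⟨h1, h0⟩ := spinorHorosphere_carrier_eq_plane_iff.1 (congrArg OverlyDecorated.carrier h)
    rw [spinorHorosphere_eq_horizontalHorosphere h1 h0] at h
    have hnorm : ‖κ.1 0‖ = 1 := by
      rwa [Complex.normSq_eq_norm_sq, pow_eq_one_iff_of_nonneg (norm_nonneg _) two_ne_zero] at h0
    have hI := injOn_horizontalHorosphere (by simp [hnorm]) (by simp) h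
    exact ⟨h1, (mul_eq_left₀ Complex.I_ne_zero).1 hI⟩
  · rintro ⟨h1, h0⟩
    have hnorm : Complex.normSq (κ.1 0) = 1 := by
      rw [Complex.normSq_eq_norm_sq, ← norm_pow, h0, norm_one]
    rw [spinorHorosphere_eq_horizontalHorosphere h1 hnorm, h0, mul_one]

theorem spinorHorosphere_eq_iff {κ μ : Spinor} :
    spinorHorosphere κ = spinorHorosphere μ ↔ modSign κ = modSign μ := by
  have smul_congr : ∀ (A : SL2C) {κ μ : Spinor}, spinorHorosphere κ = spinorHorosphere μ →
      spinorHorosphere (A • κ) = spinorHorosphere (A • μ) := fun A κ μ h => by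
    rw [spinorHorosphere_smul, spinorHorosphere_smul, h]
  obtain ⟨A, rfl⟩ := exists_smul_baseSpinor μ
  rw [← smul_mod, ← inv_smul_eq_iff, smul_mod, ← spinorHorosphere_eq_spinorHorosphere_baseSpinor]
  constructor <;> intro h
  · simpa only [inv_smul_smul] using smul_congr A⁻¹ h
  · simpa only [smul_inv_smul] using smul_congr A h

/-- A parabolic matrix preserving the plane is upper triangular with diagonal `(±1, ±1)`, so it
maps the spinor `(1, 0)` to `±(1, 0)`. -/
theorem isParallel_spinorHorosphere_baseSpinor : (spinorHorosphere baseSpinor).IsParallel := by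
  intro A hA hAS
  rw [← spinorHorosphere_smul, spinorHorosphere_eq_spinorHorosphere_baseSpinor,
    modSign_eq_modSign_baseSpinor]
  have h0 : (A • baseSpinor).1 0 = A.1 0 0 := by
    simp [Spinor.coe_smul, coe_baseSpinor]
  have h1 : (A • baseSpinor).1 1 = A.1 1 0 := by
    simp [Spinor.coe_smul, coe_baseSpinor]
  rw [image_actUpper_spinorHorosphere, spinorHorosphere_baseSpinor] at hAS
  have h10 := (spinorHorosphere_carrier_eq_plane_iff.1 hAS).1
  rw [h1] at h10
  have hdet := A.2
  rw [Matrix.det_fin_two, h10, mul_zero, sub_zero] at hdet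
  rw [h0, h1]
  rw [Matrix.trace_fin_two] at hA
  refine ⟨h10, sq_eq_one_iff.2 (hA.imp (fun htr => ?_) fun htr => ?_)⟩
  · have hsq : (A.1 0 0 - 1) ^ 2 = 0 := by linear_combination A.1 0 0 * htr - hdet
    exact sub_eq_zero.1 (pow_eq_zero_iff two_ne_zero |>.1 hsq)
  · have hsq : (A.1 0 0 + 1) ^ 2 = 0 := by linear_combination A.1 0 0 * htr - hdet
    exact eq_neg_of_add_eq_zero_left (pow_eq_zero_iff two_ne_zero |>.1 hsq)

theorem isParallel_spinorHorosphere (κ : Spinor) : (spinorHorosphere κ).IsParallel := by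
  obtain ⟨A, rfl⟩ := exists_smul_baseSpinor κ
  rw [spinorHorosphere_smul]
  exact isParallel_map_actUpper
    (isHorosphere_iff_exists_spinorHorosphere.2 ⟨_, rfl⟩).subset_upperHalf
    (isOrientedLineField_spinorHorosphere _) isParallel_spinorHorosphere_baseSpinor A

end Plane

section Surjective

/-- The parabolic matrix `((1, b), (0, 1))`, which acts on the upper half space as the horizontal
translation by `b`. -/
def shear (b : ℂ) : SL2C := ⟨!![1, b; 0, 1], by simp [Matrix.det_fin_two]⟩

theorem coe_shear (b : ℂ) : (shear b : Matrix (Fin 2) (Fin 2) ℂ) = !![1, b; 0, 1] := rfl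

theorem trace_shear (b : ℂ) : (shear b).1.trace = 2 := by
  rw [coe_shear, Matrix.trace_fin_two_of, one_add_one_eq_two]

theorem shear_smul_baseSpinor (b : ℂ) : shear b • baseSpinor = baseSpinor := by
  refine Subtype.ext ((Spinor.coe_smul _ _).trans ?_)
  rw [coe_shear, coe_baseSpinor]
  ext i
  fin_cases i <;> simp

theorem actMink_shear (b : ℂ) (p : Mink) :
    actMink (shear b) p =
      ![p 0 + (b.re * p 1 + b.im * p 2 + (b.re ^ 2 + b.im ^ 2) * (p 0 - p 3) / 2),
        p 1 + b.re * (p 0 - p 3), p 2 + b.im * (p 0 - p 3),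
        p 3 + (b.re * p 1 + b.im * p 2 + (b.re ^ 2 + b.im ^ 2) * (p 0 - p 3) / 2)] := by
  have hstar : star !![1, b; 0, 1] = !![1, 0; star b, 1] := by
    ext i j
    fin_cases i <;> fin_cases j <;> simp [Matrix.star_apply]
  ext i
  fin_cases i <;>
    simp [actMink, actHerm, coe_shear, hstar, hermEquiv, herm] <;> ring

theorem actUpper_shear (b : ℂ) {y : R3} (hy : y ∈ upperHalf) :
    actUpper (shear b) y = y + ![b.re, b.im, 0] := by
  obtain ⟨x, hx, rfl⟩ : ∃ x ∈ hyperboloid, toUpperHalf x = y :=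
    ⟨_, ofUpperHalf_mem hy, toUpperHalf_ofUpperHalf hy⟩
  have h := (sub_pos_of_mem_hyperboloid hx).ne'
  rw [actUpper_toUpperHalf _ hx]
  ext i
  fin_cases i <;> simp [toUpperHalf, actMink_shear] <;> field_simp

theorem fderiv_actUpper_shear (b : ℂ) {y : R3} (hy : y ∈ upperHalf) (w : R3) :
    fderiv ℝ (actUpper (shear b)) y w = w := by
  refine fderiv_apply_eq_of_line (differentiableAt_actUpper _ hy) ?_
  have hc : ContinuousAt (fun s : ℝ => y + s • w) 0 := by fun_prop
  have hU : ∀ᶠ s : ℝ in 𝓝 0, y + s • w ∈ upperHalf :=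
    hc.eventually_mem (isOpen_upperHalf.mem_nhds (by simpa using hy))
  filter_upwards [hU] with s hs
  rw [actUpper_shear b hs, actUpper_shear b hy, add_right_comm]

theorem apply_two_eq_zero_of_mem_tangentVectors {q w : R3} {c : ℝ}
    (hw : w ∈ tangentVectors {y : R3 | y 2 = c} q) : w 2 = 0 := by
  obtain ⟨γ, -, hγ, hd⟩ := hw
  exact (hasDerivAt_pi.1 hd 2).unique ((hasDerivAt_const (0 : ℝ) c).congr_of_eventuallyEq hγ)

variable {S : OverlyDecorated R3}

theorem map_actUpper_shear (hP : S.IsParallel) (hC : S.carrier = {y | y 2 = 1}) (b : ℂ) :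
    S.map (actUpper (shear b)) = S := by
  refine hP (shear b) (Or.inl (trace_shear b)) ?_
  have hbase : S.carrier = (spinorHorosphere baseSpinor).carrier := by
    rw [hC, spinorHorosphere_baseSpinor]
    rfl
  rw [hbase, image_actUpper_spinorHorosphere, shear_smul_baseSpinor]

theorem mem_dir_of_mem_dir_base (hP : S.IsParallel) (hC : S.carrier = {y | y 2 = 1}) {y w : R3}
    (hy : y 2 = 1) (hw : w ∈ S.dir ![0, 0, 1]) : w ∈ S.dir y := by
  have hbase : (![0, 0, 1] : R3) ∈ upperHalf := one_pos (α := ℝ)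
  rw [← map_actUpper_shear hP hC ⟨y 0, y 1⟩]
  refine ⟨![0, 0, 1], by rw [hC]; rfl, ?_, w, hw, (fderiv_actUpper_shear _ hbase w).symm⟩
  rw [actUpper_shear _ hbase]
  ext i
  fin_cases i <;> simp [hy]

theorem exists_eq_horizontalHorosphere (hS : S.IsOrientedLineField) (hP : S.IsParallel)
    (hC : S.carrier = {y | y 2 = 1}) : ∃ w : ℂ, w ≠ 0 ∧ S = horizontalHorosphere w := by
  obtain ⟨w, hw, hw0, hdir⟩ := hS.1 ![0, 0, 1] (by rw [hC]; rfl)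
  rw [hC] at hw
  have hw2 := apply_two_eq_zero_of_mem_tangentVectors hw
  have hwvec : ![w 0, w 1, 0] = w := by
    ext i
    fin_cases i <;> simp [hw2]
  refine ⟨⟨w 0, w 1⟩, fun h => hw0 ?_, OverlyDecorated.ext hC (funext fun y => ?_)⟩
  · rw [← hwvec, show w 0 = 0 from congrArg Complex.re h, show w 1 = 0 from congrArg Complex.im h]
    simp
  by_cases hy : y 2 = 1
  · have hwy := mem_dir_of_mem_dir_base hP hC hy (hdir.ge (self_mem_openRay w))
    rw [hS.dir_eq_openRay hwy, ← hwvec]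
    exact Set.ext fun v => (and_iff_right hy).symm
  · rw [hS.2 y (by rwa [hC])]
    exact (Set.eq_empty_iff_forall_notMem.2 fun v hv => hy hv.1).symm

theorem exists_spinorHorosphere_eq_horizontalHorosphere {w : ℂ} (hw : w ≠ 0) :
    ∃ κ, spinorHorosphere κ = horizontalHorosphere w := by
  have hn : 0 < ‖w‖ := norm_pos_iff.2 hw
  obtain ⟨ξ, hξ⟩ := IsAlgClosed.exists_pow_nat_eq (-Complex.I * w / ‖w‖) two_pos
  have hnorm : ‖ξ‖ ^ 2 = 1 := by
    rw [← norm_pow, hξ, norm_div, norm_mul, norm_neg, Complex.norm_I, one_mul, Complex.norm_real,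
      norm_norm, div_self hn.ne']
  have hξ0 : ξ ≠ 0 := by
    rintro rfl
    simp at hnorm
  refine ⟨⟨![ξ, 0], fun h => hξ0 (congrFun h 0)⟩, ?_⟩
  rw [spinorHorosphere_eq_horizontalHorosphere rfl ((Complex.normSq_eq_norm_sq ξ).trans hnorm),
    ← horizontalHorosphere_ofReal_mul hn]
  congr 1
  change ‖w‖ * (Complex.I * ξ ^ 2) = w
  have hnC : (‖w‖ : ℂ) ≠ 0 := Complex.ofReal_ne_zero.2 hn.ne'
  rw [hξ]
  field_simp
  linear_combination -Complex.I_sq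

/-- The decorated horosphere of a spinor. -/
def mapK (κ : Spinor) : DecoratedHorosphere :=
  ⟨spinorHorosphere κ, isHorosphere_iff_exists_spinorHorosphere.2 ⟨κ, rfl⟩,
    isOrientedLineField_spinorHorosphere κ, isParallel_spinorHorosphere κ⟩

theorem mapK_smul (A : SL2C) (κ : Spinor) : mapK (A • κ) = A • mapK κ :=
  Subtype.ext (spinorHorosphere_smul A κ)

theorem mapK_eq_iff {κ μ : Spinor} : mapK κ = mapK μ ↔ modSign κ = modSign μ :=
  Subtype.ext_iff.trans spinorHorosphere_eq_iff

theorem exists_smul_carrier_eq_plane (D : DecoratedHorosphere) :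
    ∃ A : SL2C, (A • D).1.carrier = {y | y 2 = 1} := by
  obtain ⟨κ, hκ⟩ := isHorosphere_iff_exists_spinorHorosphere.1 D.2.1
  obtain ⟨A, rfl⟩ := exists_smul_baseSpinor κ
  refine ⟨A⁻¹, ?_⟩
  change actUpper A⁻¹ '' D.1.carrier = _
  rw [hκ, image_actUpper_spinorHorosphere, inv_smul_smul, spinorHorosphere_baseSpinor]
  rfl

theorem mapK_surjective : Function.Surjective mapK := by
  intro D
  obtain ⟨A, hA⟩ := exists_smul_carrier_eq_plane D
  obtain ⟨w, hw, hAD⟩ := exists_eq_horizontalHorosphere (A • D).2.2.1 (A • D).2.2.2 hA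
  obtain ⟨κ, hκ⟩ := exists_spinorHorosphere_eq_horizontalHorosphere hw
  refine ⟨A⁻¹ • κ, ?_⟩
  rw [mapK_smul, inv_smul_eq_iff]
  exact Subtype.ext (hκ.trans hAD.symm)

end Surjective

/-! ## The coordinates of the horosphere of a spinor -/

section DiscModel

theorem iMap_eq_smul_vecTail (x : Mink) : iMap x = (1 + x 0)⁻¹ • Matrix.vecTail x := by
  ext i
  fin_cases i <;> exact div_eq_inv_mul _ _

theorem iInv_eq_smul_vecCons (y : R3) :
    iInv y = (1 - y ⬝ᵥ y)⁻¹ • Matrix.vecCons (1 + y ⬝ᵥ y) ((2 : ℝ) • y) := by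
  ext i
  fin_cases i <;> exact div_eq_inv_mul _ _

theorem iInv_mem_hyperboloid {y : R3} (hy : y ∈ disc) : iInv y ∈ hyperboloid := by
  have h : 0 < 1 - y ⬝ᵥ y := sub_pos.2 hy
  have hn : 0 ≤ y ⬝ᵥ y := Finset.sum_nonneg fun i _ => mul_self_nonneg (y i)
  refine ⟨?_, div_pos (add_pos_of_pos_of_nonneg one_pos hn) h⟩
  rw [iInv_eq_smul_vecCons, minkInner_smul_left, minkInner_smul_right, minkInner_eq_sub_dotProduct,
    Matrix.tail_cons, Matrix.cons_val_zero, smul_dotProduct, dotProduct_smul, smul_eq_mul,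
    smul_eq_mul]
  field_simp
  ring

theorem iMap_iInv {y : R3} (hy : y ∈ disc) : iMap (iInv y) = y := by
  have h : 1 - y ⬝ᵥ y ≠ 0 := (sub_pos.2 hy).ne'
  rw [iMap_eq_smul_vecTail, iInv_eq_smul_vecCons, Matrix.smul_cons, Matrix.tail_cons, smul_smul,
    smul_smul, Matrix.cons_val_zero, smul_eq_mul]
  convert one_smul ℝ y
  field_simp
  ring

theorem iInv_iMap {x : Mink} (hx : x ∈ hyperboloid) : iInv (iMap x) = x := by
  have h : 1 + x 0 ≠ 0 := (add_pos one_pos hx.2).ne'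
  have hxx := one_sub_iMap_dotProduct_self hx
  have hadd : 1 + iMap x ⬝ᵥ iMap x = x 0 * (2 / (1 + x 0)) := by
    rw [← sub_sub_self 1 (iMap x ⬝ᵥ iMap x), hxx]
    field_simp
    ring
  rw [iInv_eq_smul_vecCons, hadd, hxx, iMap_eq_smul_vecTail, Matrix.smul_cons, smul_smul, smul_smul,
    smul_eq_mul]
  convert Matrix.cons_head_tail x using 2
  · field_simp
    rfl
  · convert one_smul ℝ (Matrix.vecTail x)
    field_simp

theorem fderiv_iMap {x w : Mink} (hx : x ∈ hyperboloid) (hw : w 0 = 0) :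
    fderiv ℝ iMap x w = (1 + x 0)⁻¹ • Matrix.vecTail w := by
  refine fderiv_apply_eq_of_line (differentiableAt_iMap hx) (Filter.Eventually.of_forall ?_)
  intro s
  have h0 : (x + s • w) 0 = x 0 := by simp [hw]
  rw [iMap_eq_smul_vecTail, iMap_eq_smul_vecTail, h0, Matrix.tail_add, smul_add,
    smul_comm s]
  rfl

theorem tanh_half (t : ℝ) : Real.tanh (t / 2) = (Real.exp t - 1) / (Real.exp t + 1) := by
  have h : Real.exp t = Real.exp (t / 2) * Real.exp (t / 2) := by rw [← Real.exp_add, add_halves]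
  rw [Real.tanh_eq_sinh_div_cosh, Real.sinh_eq, Real.cosh_eq, Real.exp_neg, h]
  field_simp

theorem minkInner_iInv_eq_one_iff {u y : R3} (hu : u ⬝ᵥ u = 1) (hy : y ∈ disc) (t : ℝ) :
    minkInner (iInv y) (Real.exp t • Matrix.vecCons 1 u) = 1 ↔
      (y - Real.tanh (t / 2) • u) ⬝ᵥ (y - u) = 0 := by
  have h : 1 - y ⬝ᵥ y ≠ 0 := (sub_pos.2 hy).ne'
  have hE : Real.exp t + 1 ≠ 0 := by positivity
  have hinner : minkInner (iInv y) (Real.exp t • Matrix.vecCons 1 u) =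
      Real.exp t * (1 + y ⬝ᵥ y - 2 * (y ⬝ᵥ u)) / (1 - y ⬝ᵥ y) := by
    rw [iInv_eq_smul_vecCons, minkInner_smul_left, minkInner_smul_right,
      minkInner_eq_sub_dotProduct, Matrix.tail_cons, Matrix.tail_cons, smul_dotProduct]
    simp only [Matrix.cons_val_zero, smul_eq_mul]
    field_simp
  have hdot : (y - Real.tanh (t / 2) • u) ⬝ᵥ (y - u) =
      (Real.exp t * (1 + y ⬝ᵥ y - 2 * (y ⬝ᵥ u)) - (1 - y ⬝ᵥ y)) / (Real.exp t + 1) := by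
    simp only [sub_dotProduct, dotProduct_sub, smul_dotProduct, smul_eq_mul, hu,
      dotProduct_comm u y, tanh_half]
    field_simp
    ring
  rw [hinner, hdot, div_eq_one_iff_eq h, div_eq_zero_iff, or_iff_left hE, sub_eq_zero]

/-- The point at signed distance `t` from `(1, 0, 0, 0)` towards `u`, on the hyperboloid. -/
def footPoint (u : R3) (t : ℝ) : Mink := Matrix.vecCons (Real.cosh t) (Real.sinh t • u)

theorem footPoint_mem_hyperboloid {u : R3} (hu : u ⬝ᵥ u = 1) (t : ℝ) :
    footPoint u t ∈ hyperboloid := by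
  refine ⟨?_, Real.cosh_pos t⟩
  rw [footPoint, minkInner_eq_sub_dotProduct, Matrix.tail_cons, Matrix.cons_val_zero,
    smul_dotProduct, dotProduct_smul, hu, smul_eq_mul, smul_eq_mul, mul_one]
  linear_combination Real.cosh_sq t

theorem minkInner_footPoint {u : R3} (hu : u ⬝ᵥ u = 1) (t : ℝ) :
    minkInner (footPoint u t) (Real.exp t • Matrix.vecCons 1 u) = 1 := by
  rw [footPoint, minkInner_smul_right, minkInner_eq_sub_dotProduct, Matrix.tail_cons,
    Matrix.tail_cons, Matrix.cons_val_zero, Matrix.cons_val_zero, smul_dotProduct, hu, smul_eq_mul,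
    mul_one, mul_one, Real.cosh_sub_sinh, ← Real.exp_add, add_neg_cancel, Real.exp_zero]

theorem iMap_footPoint (u : R3) (t : ℝ) : iMap (footPoint u t) = Real.tanh (t / 2) • u := by
  rw [iMap_eq_smul_vecTail, footPoint, Matrix.tail_cons, Matrix.cons_val_zero, smul_smul, tanh_half,
    Real.sinh_eq, Real.cosh_eq, Real.exp_neg]
  congr 1
  have : Real.exp t + 1 ≠ 0 := by positivity
  field_simp
  ring

end DiscModel

section HasCoordinates

theorem nullVec_eq_exp_smul_vecCons (κ : Spinor) :
    nullVec κ = Real.exp (coords κ).2 • Matrix.vecCons 1 (coords κ).1.1.1 := by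
  rw [coords, Real.exp_log (nullVec_zero_pos κ.ne_zero)]
  exact nullVec_eq_smul_vecCons κ.ne_zero

theorem image_iMap_mapH_spinorFlag (κ : Spinor) :
    iMap '' (mapH (spinorFlag κ)).carrier = {y | y ∈ disc ∧
      (y - Real.tanh ((coords κ).2 / 2) • (coords κ).1.1.1) ⬝ᵥ (y - (coords κ).1.1.1) = 0} := by
  have hu := (coords κ).1.2.1
  have hp : (spinorFlag κ).point = _ := nullVec_eq_exp_smul_vecCons κ
  ext y
  constructor
  · rintro ⟨x, ⟨hx, hxp⟩, rfl⟩
    refine ⟨iMap_mem_disc hx, (minkInner_iInv_eq_one_iff hu (iMap_mem_disc hx) _).1 ?_⟩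
    rwa [iInv_iMap hx, ← hp]
  · rintro ⟨hy, h⟩
    refine ⟨iInv y, ⟨iInv_mem_hyperboloid hy, ?_⟩, iMap_iInv hy⟩
    rw [hp]
    exact (minkInner_iInv_eq_one_iff hu hy _).2 h

theorem flagDirection_mem_mapI_mapH_dir (κ : Spinor) :
    (coords κ).1.1.2 ∈ (mapI (mapH (spinorFlag κ))).dir
      (Real.tanh ((coords κ).2 / 2) • (coords κ).1.1.1) := by
  set u := (coords κ).1.1.1
  set v := (coords κ).1.1.2
  set t := (coords κ).2
  have hx := footPoint_mem_hyperboloid (coords κ).1.2.1 t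
  have hxS : footPoint u t ∈ (mapH (spinorFlag κ)).carrier := by
    refine ⟨hx, ?_⟩
    rw [spinorFlag_point, nullVec_eq_exp_smul_vecCons]
    exact minkInner_footPoint (coords κ).1.2.1 t
  have hflag : flagVec κ = (2 * nullVec κ 0) • Matrix.vecCons 0 v :=
    flagVec_eq_smul_vecCons κ.ne_zero
  have horth : minkInner (flagVec κ) (footPoint u t) = 0 := by
    rw [hflag, minkInner_smul_left, minkInner_eq_sub_dotProduct, footPoint, Matrix.tail_cons,
      Matrix.tail_cons, dotProduct_smul, dotProduct_comm, (coords κ).1.2.2.2]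
    simp
  have hdir : (1 + footPoint u t 0) • Matrix.vecCons 0 v ∈
      (mapH (spinorFlag κ)).dir (footPoint u t) := by
    rw [mapH_dir (minkInner_flagVec_nullVec κ) (spinorFlag_pos κ) hxS, horth, zero_smul, sub_zero,
      hflag, openRay_smul (mul_pos two_pos (nullVec_zero_pos κ.ne_zero))]
    exact ⟨_, add_pos one_pos hx.2, rfl⟩
  refine ⟨footPoint u t, hxS, iMap_footPoint u t, _, hdir, ?_⟩
  rw [map_smul, fderiv_iMap hx rfl, Matrix.tail_cons, smul_inv_smul₀ (add_pos one_pos hx.2).ne']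

theorem hasCoordinates_mapK (κ : Spinor) : HasCoordinates (mapK κ) (coords κ) := by
  refine ⟨congrArg (jMap '' ·) (image_iMap_mapH_spinorFlag κ), ?_⟩
  obtain ⟨x, hx, hxq, -⟩ := flagDirection_mem_mapI_mapH_dir κ
  exact ⟨_, ⟨x, hx, hxq⟩, rfl, _, flagDirection_mem_mapI_mapH_dir κ, rfl⟩

end HasCoordinates

/-! ## The bijection and the action of `PSL(2, ℂ)` -/

section Conclusion

/-- The map from spinors up to sign to decorated horospheres induced by `mapK`. -/
def mapKEquiv : SpinorModSign ≃ DecoratedHorosphere :=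
  modSignEquiv mapK mapK_surjective fun _ _ => mapK_eq_iff

theorem mapKEquiv_modSign (κ : Spinor) : mapKEquiv (modSign κ) = mapK κ :=
  modSignEquiv_modSign _ _ κ

theorem mapKEquiv_smul (A : SL2C) (x : SpinorModSign) : mapKEquiv (A • x) = A • mapKEquiv x := by
  induction x using Quotient.inductionOn with
  | h κ => exact mapK_smul A κ

theorem ncard_preimage_mapK (D : DecoratedHorosphere) : (mapK ⁻¹' {D}).ncard = 2 := by
  obtain ⟨κ, rfl⟩ := mapK_surjective D
  have hfibre : mapK ⁻¹' {mapK κ} = {κ, (-1 : ℤˣ) • κ} := by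
    ext μ
    rw [Set.mem_preimage, Set.mem_singleton_iff, eq_comm, mapK_eq_iff, modSign_eq_iff,
      ← Spinor.coe_neg_one_smul, Subtype.coe_inj, Subtype.coe_inj, Set.mem_insert_iff,
      Set.mem_singleton_iff]
  rw [hfibre, Set.ncard_pair (Spinor.neg_one_smul_ne κ).symm]

/-- The bijection between `UTS² × ℝ` and decorated horospheres. -/
def horosphereEquiv : UTS2 × ℝ ≃ DecoratedHorosphere :=
  coordsEquiv.symm.trans mapKEquiv

theorem horosphereEquiv_symm_mapKEquiv (x : SpinorModSign) :
    horosphereEquiv.symm (mapKEquiv x) = coordsEquiv x :=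
  congrArg coordsEquiv (mapKEquiv.symm_apply_apply x)

theorem hasCoordinates_horosphereEquiv (x : UTS2 × ℝ) : HasCoordinates (horosphereEquiv x) x := by
  obtain ⟨κ, rfl⟩ := coords_surjective x
  have h : horosphereEquiv (coords κ) = mapK κ := by
    rw [← coordsEquiv_modSign, ← horosphereEquiv_symm_mapKEquiv, Equiv.apply_symm_apply,
      mapKEquiv_modSign]
  rw [h]
  exact hasCoordinates_mapK κ

theorem smul_eq_self_of_mem_center {A : SL2C} (hA : A ∈ Subgroup.center SL2C) (x : SpinorModSign) :
    A • x = x := by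
  induction x using Quotient.inductionOn with
  | h κ =>
    obtain ⟨r, hr, hrA⟩ := Matrix.SpecialLinearGroup.mem_center_iff.1 hA
    have hsmul : ((A • κ : Spinor) : Fin 2 → ℂ) = r • (κ : Fin 2 → ℂ) := by
      rw [Spinor.coe_smul, ← hrA, Matrix.scalar_apply, Matrix.diagonal_const_mulVec]
    refine (modSign_eq_iff.2 ?_).symm
    rw [Fintype.card_fin, sq_eq_one_iff] at hr
    exact hr.imp (fun h => by rw [hsmul, h, one_smul]) fun h => by rw [hsmul, h, neg_one_smul]

theorem exists_quotient_toPermHom {G X : Type*} [Group G] [MulAction G X] {N : Subgroup G}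
    [N.Normal] (h : ∀ g ∈ N, ∀ x : X, g • x = x) :
    ∃ ρ : G ⧸ N →* Equiv.Perm X, ∀ (g : G) x, ρ (QuotientGroup.mk g) x = g • x :=
  ⟨QuotientGroup.lift N (MulAction.toPermHom G X) fun g hg => Equiv.ext (h g hg), fun _ _ => rfl⟩

end Conclusion

end

end SpinorHoro

theorem mainTheorem8 :
    ∃ (Θ : UTS2 × ℝ ≃ DecoratedHorosphere) (σ : SL2C →* Equiv.Perm DecoratedHorosphere)
      (K : Spinor → DecoratedHorosphere) (Kq : SpinorModSign → DecoratedHorosphere),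
      (∀ x, HasCoordinates (Θ x) x) ∧
      (∀ A D, (σ A D).1 = D.1.map (actUpper A)) ∧
      (∀ κ, (K κ).1 = mapJ (mapI (mapH (mapG (mapF κ))))) ∧
      (∀ κ, Kq (modSign κ) = K κ) ∧
      SmoothToUTS2 (fun κ => Θ.symm (K κ)) ∧
      Function.Surjective K ∧
      (∀ D, (K ⁻¹' {D}).ncard = 2) ∧
      (∀ A κ, K (A • κ) = σ A (K κ)) ∧
      SmoothToUTS2 (fun x => Θ.symm (Kq x)) ∧
      Function.Bijective Kq ∧
      (∀ (A : SL2C) x, Kq (A • x) = σ A (Kq x)) ∧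
      (∃ ρ : PSL2C →* Equiv.Perm SpinorModSign, ∀ (A : SL2C) x, ρ (QuotientGroup.mk A) x = A • x) ∧
      ∃ ρ : PSL2C →* Equiv.Perm DecoratedHorosphere,
        ∀ A D, ρ (QuotientGroup.mk A) D = σ A D := by
  refine ⟨horosphereEquiv, MulAction.toPermHom SL2C DecoratedHorosphere, mapK, mapKEquiv,
    hasCoordinates_horosphereEquiv, DecoratedHorosphere.coe_smul, fun _ => rfl, mapKEquiv_modSign,
    ?_, mapK_surjective, ncard_preimage_mapK, mapK_smul, ?_, mapKEquiv.bijective, mapKEquiv_smul,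
    exists_quotient_toPermHom fun _ hA => smul_eq_self_of_mem_center hA,
    exists_quotient_toPermHom fun A hA D => ?_⟩
  · simpa only [← mapKEquiv_modSign, horosphereEquiv_symm_mapKEquiv, coordsEquiv_modSign] using
      smoothToUTS2_coords
  · simpa only [horosphereEquiv_symm_mapKEquiv] using smoothToUTS2_coordsEquiv
  · obtain ⟨x, rfl⟩ := mapKEquiv.surjective D
    rw [← mapKEquiv_smul, smul_eq_self_of_mem_center hA]
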